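/- Let $K$ be a field, let $X=(X_{ij})$ be an $m\times n$ matrix of indeterminates over $K$, let $1\le t\le\min(m,n)$, and let $I_t\subseteq K[X]$ be the ideal generated by the $t$-minors of $X$. **Standard bitableaux.** For $1\le a_1<\dots<a_s\le m$ and $1\le b_1<\dots<b_s\le n$ with $s\ge 1$, let $[a_1\dots a_s\,|\,b_1\dots b_s]=\det(X_{a_ib_j})$ be the corresponding minor of size $s$. Put $[a_1\dots a_s\,|\,b_1\dots b_s]\preceq[c_1\dots c_u\,|\,d_1\dots d_u]$ if $s\ge u$ and $a_i\le c_i$, $b_i\le d_i$ for $i=1,\dots,u$. A standard bitableau is a sequence $\Sigma=(\delta_1,\dots,\delta_w)$, $w\ge 0$, of minors (given by their row and column indices) with $\delta_1\preceq\dots\preceq\delta_w$. It stands for the product $\delta_1\cdots\delta_w\in K[X]$; its left tableau $A$ and its right tableau $B$ have as $i$-th row the row indices and the column indices of $\delta_i$, respectively. **The KRS correspondence.** The KRS monomial of $\Sigma$ is computed as follows. As long as the tableaux are not empty, let $\ell$ be the largest entry of $A$ and let $p$ be the largest index of a row of $A$ containing $\ell$. Remove $\ell$ from the $p$-th row of $A$.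 Remove the last entry $x$ from the $p$-th row of $B$; then, for $i=p-1,p-2,\dots,1$ successively, replace the last entry $\le x$ of the $i$-th row of $B$ by $x$, and let $x$ from then on denote the entry that was replaced. Let $r$ be the final value of $x$, record the pair $(\ell,r)$, and continue with the new tableaux. Then $\mathrm{KRS}(\Sigma)$ is the monomial $\prod X_{\ell r}$ over all recorded pairs $(\ell,r)$ (it is $1$ for the empty bitableau). **Initial ideals.** For a monomial order on $K[X]$, let $\mathrm{in}(f)$ be the initial monomial of $f\ne 0$. For an ideal $J$ of $K[X]$, let $\mathrm{in}(J)$ be the $K$-vector space spanned by the monomials $\mathrm{in}(f)$, $0\neq f\in J$. A subset $F\subseteq J$ is a Gröbner basis of $J$ if $\mathrm{in}(J)$ is the ideal generated by the monomials $\mathrm{in}(f)$, $0\ne f\in F$. The order is called diagonal if $\mathrm{in}([a_1\dots a_s\,|\,b_1\dots b_s])=X_{a_1b_1}\cdots X_{a_sb_s}$ for every minor of $X$. **Theorem (Sturmfels).** For every diagonal monomial order on $K[X]$: 1. The $t$-minors of $X$ form a Gröbner basis of $I_t$. 2. The standard bitableaux $(\delta_1,\dots,\delta_w)$ with $w\ge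 1$ and $\delta_1$ of size $\ge t$ form a $K$-basis of $I_t$, and $\mathrm{in}(I_t)$ is the $K$-span of the monomials $\mathrm{KRS}(\Sigma)$ of the elements $\Sigma$ of this basis. 3. The map $\Sigma\mapsto\mathrm{KRS}(\Sigma)$ extends to exactly one $K$-linear map $\mathrm{KRS}\colon K[X]\to K[X]$, this map is an automorphism of the $K$-vector space $K[X]$, and $\mathrm{in}(I_t)=\mathrm{KRS}(I_t)$. -/

import Mathlib

namespace DetIdeal

open MvPolynomial

/-! ### Deletion and the Knuth-Robinson-Schensted algorithm -/

section Algorithm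

variable {α β : Type*} [LinearOrder α] [LinearOrder β]

/-- Replace the rightmost entry `x ≤ y` of a row by `y`; the output is `x` together with the new
row (`none` if there is no entry `≤ y`). -/
def bump (y : β) : List β → Option (β × List β)
  | [] => none
  | a :: l =>
    match bump y l with
    | some (x, l') => some (x, a :: l')
    | none => if a ≤ y then some (a, y :: l) else none

/-- Deletion of a tableau, given by the list of its rows, at the row of index `p` (rows are counted
from `0`): the last entry of row `p` is removed and bumped into the row above it, the entry replaced
there is bumped into the next higher row, and so on. The output is the entry that leaves the first
row, together with the new tableau. A row that has lost its last entry stays as an empty row. -/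
def deletion : List (List β) → ℕ → Option (β × List (List β))
  | [], _ => none
  | row :: rest, 0 => row.getLast?.map fun x => (x, row.dropLast :: rest)
  | row :: rest, p + 1 =>
    match deletion rest p with
    | none => none
    | some (y, rest') => (bump y row).map fun z => (z.1, z.2 :: rest')

/-- The index of the lowest row that contains `x` (`0` if there is none). -/
def lowestRow (x : α) : List (List α) → ℕ
  | [] => 0
  | _ :: rest => if ∃ r ∈ rest, x ∈ r then lowestRow x rest + 1 else 0

/-- One step of the KRS algorithm for a pair of tableaux `(A | B)`: let `a` be the largest entry
of `A` and `p` the lowest row of `A` in which it occurs; remove `a` from row `p` of `A`, and apply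
deletion to `(B, p)`, with output `b`. The result is the pair `(a, b)` and the new pair of
tableaux. -/
def krsStep (A : List (List α)) (B : List (List β)) :
    Option ((α × β) × (List (List α) × List (List β))) :=
  match A.flatten.max? with
  | none => none
  | some a =>
    (deletion B (lowestRow a A)).map fun z =>
      ((a, z.1), (A.modify (lowestRow a A) (fun row => row.erase a), z.2))

/-- The two-line array, written as the list of its columns, that `k` steps of the KRS algorithm
produce; the pair found in the first step is the last column. -/
def krsArray : ℕ → List (List α) → List (List β) → List (α × β)
  | 0, _, _ => []
  | k + 1, A, B =>
    match krsStep A B with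
    | none => []
    | some (c, A', B') => krsArray k A' B' ++ [c]

end Algorithm

/-! ### Minors and standard bitableaux -/

/-- The index data `[a₁ … aₛ | b₁ … bₛ]` of a non-empty minor of an `m × n` matrix, with
`a₁ < … < aₛ` and `b₁ < … < bₛ`. -/
structure Minor (m n : ℕ) where
  size : ℕ
  size_pos : 0 < size
  row : Fin size ↪o Fin m
  col : Fin size ↪o Fin n

namespace Minor

variable {m n : ℕ}

/-- The minor as a polynomial in the entries of the generic `m × n` matrix. -/
noncomputable def toPoly (K : Type*) [Field K] (d : Minor m n) :
    MvPolynomial (Fin m × Fin n) K :=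
  ((Matrix.mvPolynomialX (Fin m) (Fin n) K).submatrix d.row d.col).det

/-- The exponent of the main diagonal of the minor, the monomial `∏ i, X (a i, b i)`. -/
noncomputable def diag (d : Minor m n) : (Fin m × Fin n) →₀ ℕ :=
  ∑ i, Finsupp.single (d.row i, d.col i) 1

/-- The partial order on minors: `[a₁ … aₛ | b₁ … bₛ] ≼ [c₁ … cᵤ | d₁ … dᵤ]` iff `u ≤ s` and
`aᵢ ≤ cᵢ`, `bᵢ ≤ dᵢ` for `i = 1, …, u`. -/
def Prec (d e : Minor m n) : Prop :=
  ∃ h : e.size ≤ d.size, ∀ i : Fin e.size,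
    d.row (Fin.castLE h i) ≤ e.row i ∧ d.col (Fin.castLE h i) ≤ e.col i

end Minor

/-- A standard bitableau: a sequence `δ₁ ≼ … ≼ δ_w` of minors (the empty one is allowed). -/
structure StdBitableau (m n : ℕ) where
  minors : List (Minor m n)
  chain : minors.IsChain Minor.Prec

namespace StdBitableau

variable {m n : ℕ}

/-- The product of minors that the bitableau stands for. -/
noncomputable def toPoly (K : Type*) [Field K] (S : StdBitableau m n) :
    MvPolynomial (Fin m × Fin n) K :=
  (S.minors.map (Minor.toPoly K)).prod

/-- The left tableau, row by row. -/
def left (S : StdBitableau m n) : List (List (Fin m)) :=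
  S.minors.map fun d => List.ofFn d.row

/-- The right tableau, row by row. -/
def right (S : StdBitableau m n) : List (List (Fin n)) :=
  S.minors.map fun d => List.ofFn d.col

/-- The length of the first row, i.e. the size of the first minor (`0` for the empty bitableau). -/
def firstLength (S : StdBitableau m n) : ℕ :=
  match S.minors with
  | [] => 0
  | d :: _ => d.size

/-- The two-line array `KRS(S)`; the number of steps is the number of entries of a tableau. -/
def array (S : StdBitableau m n) : List (Fin m × Fin n) :=
  krsArray (S.minors.map Minor.size).sum S.left S.right

/-- The exponent of the monomial `KRS(S)`, the product of the indeterminates whose positions are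
the columns of the two-line array. -/
noncomputable def krsExp (S : StdBitableau m n) : (Fin m × Fin n) →₀ ℕ :=
  (S.array.map fun c => Finsupp.single c 1).sum

/-- The monomial `KRS(S)`. -/
noncomputable def krs (K : Type*) [Field K] (S : StdBitableau m n) :
    MvPolynomial (Fin m × Fin n) K :=
  monomial S.krsExp 1

end StdBitableau

/-- A linear endomorphism of the polynomial ring that sends every standard bitableau to its KRS
monomial. -/
def ExtendsKRS {m n : ℕ} {K : Type*} [Field K]
    (f : MvPolynomial (Fin m × Fin n) K →ₗ[K] MvPolynomial (Fin m × Fin n) K) : Prop :=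
  ∀ S : StdBitableau m n, f (S.toPoly K) = S.krs K

/-! ### Determinantal ideals, initial spaces and Gröbner bases -/

/-- The set of `t`-minors of the generic `m × n` matrix. -/
noncomputable def minorSet (K : Type*) [Field K] (m n t : ℕ) : Set (MvPolynomial (Fin m × Fin n) K) :=
  {f | ∃ d : Minor m n, d.size = t ∧ d.toPoly K = f}

/-- The determinantal ideal generated by the `t`-minors of the generic `m × n` matrix. -/
noncomputable def detIdeal (K : Type*) [Field K] (m n t : ℕ) : Ideal (MvPolynomial (Fin m × Fin n) K) :=
  Ideal.span (minorSet K m n t)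

/-- The set of the initial monomials of the non-zero elements of `F`. -/
noncomputable def iniMonomials {σ : Type*} {K : Type*} [Field K] (ord : MonomialOrder σ)
    (F : Set (MvPolynomial σ K)) : Set (MvPolynomial σ K) :=
  {g | ∃ f ∈ F, f ≠ 0 ∧ g = monomial (ord.degree f) 1}

/-- The initial space of an ideal: the `K`-span of the initial monomials of its elements. -/
noncomputable def iniSpace {σ : Type*} {K : Type*} [Field K] (ord : MonomialOrder σ)
    (J : Ideal (MvPolynomial σ K)) : Submodule K (MvPolynomial σ K) :=
  Submodule.span K (iniMonomials ord (J : Set (MvPolynomial σ K)))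

/-- `F` is a Gröbner basis of the ideal `J`: it is a subset of `J`, and the initial space of `J` is
the ideal generated by the initial monomials of the elements of `F`. -/
def IsGroebnerBasis {σ : Type*} {K : Type*} [Field K] (ord : MonomialOrder σ)
    (F : Set (MvPolynomial σ K)) (J : Ideal (MvPolynomial σ K)) : Prop :=
  F ⊆ (J : Set (MvPolynomial σ K)) ∧
    iniSpace ord J = (Ideal.span (iniMonomials ord F)).restrictScalars K

/-- A diagonal term order: the initial monomial of every minor is its main diagonal. -/
def IsDiagonal (K : Type*) [Field K] {m n : ℕ} (ord : MonomialOrder (Fin m × Fin n)) : Prop :=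
  ∀ d : Minor m n, ord.degree (d.toPoly K) = d.diag

end DetIdeal

/-! The proof avoids the straightening law and the full Schensted theorem: two explicit
constructions are closed up by counting dimensions degree by degree.

Combinatorics. Sort the variables of a monomial into a two-line array and insert the columns one by
one. Deletion reverses insertion, and by the row bumping lemma each new cell of the left tableau is
the lowest occurrence of the maximal entry, so KRS applied to the resulting tableaux returns the
array (`exists_tableaux`). Hence every monomial is a KRS monomial. Each entry of the first row of
the right tableau is witnessed by a chain of the array, so if that row has length at least `t`, the
diagonal of some `t`-minor divides the monomial (`exists_bitableau`).

Independence. Substitute for `X` the product of generic `m × r` and `r × n` matrices (`factorHom`).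
For a minor of size `s ≤ r` the lex-leading monomial is the product of the main diagonals of the
left factor in rows `a₁, …, aₛ` and of the right factor in columns `b₁, …, bₛ`. A standard bitableau
can be recovered from the sum of these exponents, so those with first row at most `r` have
independent images; minors larger than `r` are killed.

Counting. In degree `N` the monomials inject into the standard bitableaux with `N` boxes, which are
independent in the space spanned by those monomials. So the injection is a bijection and the
bitableaux are a basis (`surjective_and_span_toPoly`). Laplace expansion puts bitableaux with first
row at least `t` into the ideal; the substitution with `r = t - 1` kills the ideal but keeps the
remaining bitableaux independent, so the former span it (`span_toPoly_eq_detIdeal`).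

Initial ideal. The KRS monomials of this basis are multiples of diagonals of `t`-minors, hence
initial monomials. In each degree there are no more initial monomials than basis elements, so these
are all of them (`exists_krsExp_eq_degree`), and the minors form a Gröbner basis. -/

namespace DetIdeal

open MvPolynomial

set_option linter.unusedSectionVars false

/-! ### Row insertion -/

section Insertion

variable {α β : Type*} [LinearOrder α] [LinearOrder β]

/-- Replace the leftmost entry `x ≥ y` of a row by `y`; the output is `x` together with the new
row (`none` if there is no entry `≥ y`). -/
def rowBump (y : β) : List β → Option (β × List β)
  | [] => none
  | a :: l => if y ≤ a then some (a, y :: l) else (rowBump y l).map fun z => (z.1, a :: z.2)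

/-- The row obtained by inserting `y`: it replaces the leftmost entry `≥ y`, or is appended. -/
def rowInsert (y : β) : List β → List β
  | [] => [y]
  | a :: l => if y ≤ a then y :: l else a :: rowInsert y l

/-- Row insertion of `y` into a tableau; the output is the index of the row that has grown,
together with the new tableau. -/
def insertion : β → List (List β) → ℕ × List (List β)
  | y, [] => (0, [[y]])
  | y, row :: rest =>
    match rowBump y row with
    | none => (0, (row ++ [y]) :: rest)
    | some z => ((insertion z.1 rest).1 + 1, z.2 :: (insertion z.1 rest).2)

/-- Append `x` to the row of index `p`, which is a new row if `p` is too large. -/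
def addCell (x : α) : ℕ → List (List α) → List (List α)
  | _, [] => [[x]]
  | 0, row :: rest => (row ++ [x]) :: rest
  | p + 1, row :: rest => row :: addCell x p rest

/-- Add an empty row if `p` is not the index of a row. -/
def padTo (p : ℕ) (T : List (List α)) : List (List α) :=
  if p < T.length then T else T ++ [[]]

/-- The row `s` fits under the row `r`: it is not longer, and its entries are at least those
above them. -/
def Dominates : List β → List β → Prop
  | _, [] => True
  | [], _ :: _ => False
  | a :: r, b :: s => a ≤ b ∧ Dominates r s

/-- Tableaux with non-empty strictly increasing rows and weakly increasing columns. -/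
def IsTableau : List (List β) → Prop
  | [] => True
  | r :: T => r ≠ [] ∧ r.Pairwise (· < ·) ∧ Dominates r (T.headD []) ∧ IsTableau T

@[simp] lemma dominates_nil (r : List β) : Dominates r [] := by cases r <;> trivial

lemma rowBump_eq_none {y : β} {r : List β} (h : rowBump y r = none) :
    rowInsert y r = r ++ [y] ∧ ∀ a ∈ r, a < y := by
  induction r with
  | nil => simp [rowInsert]
  | cons a l ih =>
    simp only [rowBump] at h
    split_ifs at h with hy
    rw [Option.map_eq_none_iff] at h
    obtain ⟨h1, h2⟩ := ih h
    simp only [rowInsert, if_neg hy, h1, List.cons_append, true_and, List.mem_cons, forall_eq_or_imp]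
    exact ⟨not_le.1 hy, h2⟩

lemma rowBump_eq_some {y : β} {r : List β} {z : β × List β} (h : rowBump y r = some z) :
    rowInsert y r = z.2 ∧ y ≤ z.1 ∧ z.2.length = r.length := by
  induction r generalizing z with
  | nil => simp [rowBump] at h
  | cons a l ih =>
    simp only [rowBump] at h
    split_ifs at h with hy
    · obtain rfl := Option.some.inj h
      simp [rowInsert, hy]
    · obtain ⟨w, hw, rfl⟩ := Option.map_eq_some_iff.1 h
      obtain ⟨h1, h2, h3⟩ := ih hw
      simp [rowInsert, hy, h1, h2, h3]

lemma insertion_headD (y : β) (T : List (List β)) :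
    (insertion y T).2.headD [] = rowInsert y (T.headD []) := by
  cases T with
  | nil => simp [insertion, rowInsert]
  | cons r T =>
    simp only [insertion]
    split
    · simp [rowBump_eq_none ‹_›]
    · simp [rowBump_eq_some ‹_›]

lemma mem_rowInsert {y x : β} {r : List β} (h : x ∈ rowInsert y r) : x = y ∨ x ∈ r := by
  induction r with
  | nil => simpa [rowInsert] using h
  | cons a l ih =>
    simp only [rowInsert] at h
    split_ifs at h
    · simp only [List.mem_cons] at h ⊢; tauto
    · simp only [List.mem_cons] at h ⊢; tauto

lemma rowInsert_ne_nil (y : β) (r : List β) : rowInsert y r ≠ [] := by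
  cases r <;> simp only [rowInsert] <;> (try split_ifs) <;> simp

lemma rowInsert_pairwise {y : β} {r : List β} (h : r.Pairwise (· < ·)) :
    (rowInsert y r).Pairwise (· < ·) := by
  induction r with
  | nil => simp [rowInsert]
  | cons a l ih =>
    rw [List.pairwise_cons] at h
    simp only [rowInsert]
    split_ifs with hy
    · exact List.pairwise_cons.2 ⟨fun b hb => hy.trans_lt (h.1 b hb), h.2⟩
    · refine List.pairwise_cons.2 ⟨fun b hb => ?_, ih h.2⟩
      rcases mem_rowInsert hb with rfl | hb
      · exact not_le.1 hy
      · exact h.1 b hb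

lemma Dominates.append {r s : List β} (h : Dominates r s) (y : β) : Dominates (r ++ [y]) s := by
  induction r generalizing s with
  | nil => cases s <;> simp_all [Dominates]
  | cons a l ih =>
    cases s with
    | nil => simp
    | cons b s => exact ⟨h.1, ih h.2⟩

lemma Dominates.append_right {r s : List β} {y : β} (h : Dominates r s)
    (hl : s.length < r.length) (hy : ∀ a ∈ r, a ≤ y) : Dominates r (s ++ [y]) := by
  induction r generalizing s with
  | nil => simp at hl
  | cons a l ih =>
    cases s with
    | nil => exact ⟨hy a (by simp), by simp⟩
    | cons b s =>
      exact ⟨h.1, ih h.2 (by simpa using hl) fun c hc => hy c (List.mem_cons_of_mem _ hc)⟩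

lemma Dominates.length_le {r s : List β} (h : Dominates r s) : s.length ≤ r.length := by
  induction r generalizing s with
  | nil => cases s <;> simp_all [Dominates]
  | cons a l ih =>
    cases s with
    | nil => simp
    | cons b s => simpa using ih h.2

/-- Insertion only lowers an existing entry or appends a new one. -/
lemma Dominates.rowInsert_left {r s : List β} (h : Dominates r s) (y : β) :
    Dominates (rowInsert y r) s := by
  induction r generalizing s with
  | nil => cases s <;> simp_all [Dominates]
  | cons a l ih =>
    cases s with
    | nil => simp
    | cons b s =>
      simp only [rowInsert]
      split_ifs with hy
      · exact ⟨hy.trans h.1, h.2⟩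
      · exact ⟨h.1, ih h.2⟩

/-- The entry bumped out of a row finds its place in the next row weakly to the left. -/
lemma Dominates.rowInsert {r s : List β} {y : β} {z : β × List β} (h : Dominates r s)
    (hz : rowBump y r = some z) : Dominates z.2 (rowInsert z.1 s) := by
  induction r generalizing s z with
  | nil => simp [rowBump] at hz
  | cons a l ih =>
    simp only [rowBump] at hz
    split_ifs at hz with hy
    · obtain rfl := Option.some.inj hz
      cases s with
      | nil => exact ⟨hy, by simp⟩
      | cons b s =>
        simp only [DetIdeal.rowInsert, if_pos h.1]
        exact ⟨hy, h.2⟩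
    · obtain ⟨w, hw, rfl⟩ := Option.map_eq_some_iff.1 hz
      obtain ⟨h1, h2, -⟩ := rowBump_eq_some hw
      have ha : a ≤ w.1 := (not_le.1 hy).le.trans h2
      cases s with
      | nil => exact ⟨ha, by simp⟩
      | cons b s =>
        simp only [DetIdeal.rowInsert]
        split_ifs with hb
        · exact ⟨ha, h1 ▸ h.2.rowInsert_left y⟩
        · exact ⟨h.1, ih h.2 hw⟩

lemma isTableau_insertion {y : β} {T : List (List β)} (h : IsTableau T) :
    IsTableau (insertion y T).2 := by
  induction T generalizing y with
  | nil => simp [insertion, IsTableau]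
  | cons r T ih =>
    obtain ⟨h1, h2, h3, h4⟩ := h
    have h5 := rowInsert_pairwise (y := y) h2
    simp only [insertion]
    split
    next hb =>
      rw [(rowBump_eq_none hb).1] at h5
      exact ⟨by simp, h5, h3.append y, h4⟩
    next z hb =>
      have h6 := rowInsert_ne_nil y r
      rw [(rowBump_eq_some hb).1] at h5 h6
      refine ⟨h6, h5, ?_, ih h4⟩
      rw [insertion_headD]
      exact h3.rowInsert hb

/-! ### Deletion as the inverse of insertion -/

lemma bump_eq_none {y : β} {r : List β} (h : ∀ a ∈ r, y < a) : bump y r = none := by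
  induction r with
  | nil => rfl
  | cons a l ih =>
    simp only [List.mem_cons, forall_eq_or_imp] at h
    simp [bump, ih h.2, h.1]

/-- In a strictly increasing row all entries to the right of the bumped one exceed it, so the
rightmost entry that it can replace is the `y` that took its place. -/
lemma bump_rowBump {y : β} {r : List β} {z : β × List β} (h : r.Pairwise (· < ·))
    (hz : rowBump y r = some z) : bump z.1 z.2 = some (y, r) := by
  induction r generalizing z with
  | nil => simp [rowBump] at hz
  | cons a l ih =>
    rw [List.pairwise_cons] at h
    simp only [rowBump] at hz
    split_ifs at hz with hy
    · obtain rfl := Option.some.inj hz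
      simp [bump, bump_eq_none h.1, hy]
    · obtain ⟨w, hw, rfl⟩ := Option.map_eq_some_iff.1 hz
      simp [bump, ih h.2 hw]

lemma insertion_le (y : β) (T : List (List β)) : (insertion y T).1 ≤ T.length := by
  induction T generalizing y with
  | nil => simp [insertion]
  | cons r T ih =>
    simp only [insertion]
    split <;> simp [ih]

lemma padTo_cons (p : ℕ) (r : List α) (T : List (List α)) :
    padTo (p + 1) (r :: T) = r :: padTo p T := by
  simp only [padTo, List.length_cons, Nat.add_lt_add_iff_right]
  split_ifs <;> rfl

/-- Deletion reverses insertion. -/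
lemma deletion_insertion {y : β} {T : List (List β)} (h : IsTableau T) :
    deletion (insertion y T).2 (insertion y T).1 = some (y, padTo (insertion y T).1 T) := by
  induction T generalizing y with
  | nil => simp [insertion, deletion, padTo]
  | cons r T ih =>
    obtain ⟨h1, h2, h3, h4⟩ := h
    simp only [insertion]
    split
    next hb => simp [deletion, padTo]
    next z hb => simp [deletion, ih h4, bump_rowBump h2 hb, padTo_cons]

/-- Row bumping lemma: the insertion of a smaller or equal entry afterwards ends in a lower
row. -/
lemma insertion_lt_insertion {y y' : β} (h : y' ≤ y) (T : List (List β)) :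
    (insertion y T).1 < (insertion y' (insertion y T).2).1 := by
  -- The row now contains `y ≥ y'`, so `y'` always bumps, and what it bumps is at most `y`, hence at
  -- most whatever `y` bumped. The hypothesis therefore passes to the next row.
  have key : ∀ (r : List β) (y y' : β), y' ≤ y → ∃ z, rowBump y' (rowInsert y r) = some z ∧ z.1 ≤ y := by
    intro r y y' h
    induction r with
    | nil => simp [rowInsert, rowBump, h]
    | cons a l ih =>
      simp only [rowInsert]
      split_ifs with hy
      · simp [rowBump, h]
      · simp only [rowBump]
        split_ifs with hy'
        · exact ⟨_, rfl, (not_le.1 hy).le⟩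
        · obtain ⟨z, hz, hzy⟩ := ih
          exact ⟨(z.1, a :: z.2), by rw [hz]; rfl, hzy⟩
  induction T generalizing y y' with
  | nil => simp [insertion, rowBump, h]
  | cons r T ih =>
    obtain ⟨w, hw, hwy⟩ := key r y y' h
    rw [insertion]
    split
    next hb =>
      rw [(rowBump_eq_none hb).1] at hw
      simp [insertion, hw]
    next z hb =>
      obtain ⟨h1, h2, -⟩ := rowBump_eq_some hb
      rw [h1] at hw
      simp only [insertion, hw]
      exact Nat.add_lt_add_right (ih (hwy.trans h2)) 1

/-! ### The left tableau and one step of KRS -/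

lemma shape_addCell {x : α} {y : β} {A : List (List α)} {B : List (List β)}
    (h : A.map List.length = B.map List.length) :
    (addCell x (insertion y B).1 A).map List.length = (insertion y B).2.map List.length := by
  induction A generalizing y B with
  | nil =>
    obtain rfl : B = [] := by simpa using h.symm
    simp [insertion, addCell]
  | cons a A ih =>
    cases B with
    | nil => simp at h
    | cons b B =>
      simp only [List.map_cons, List.cons.injEq] at h
      simp only [insertion]
      split
      next hb => simp [addCell, h]
      next z hb => simp [addCell, ih h.2, h.1, (rowBump_eq_some hb).2.2]

/-- A maximal entry cannot violate a column condition, and its absence from row `p` makes that row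
strict. The tableau `T` serves only to guarantee that the enlarged shape is still a partition. -/
lemma isTableau_addCell {x : α} {p : ℕ} {A : List (List α)} {T : List (List β)}
    (hA : IsTableau A) (hT : IsTableau T) (hs : (addCell x p A).map List.length = T.map List.length)
    (hx : ∀ r ∈ A, ∀ a ∈ r, a ≤ x) (hp : ∀ r ∈ A.drop p, x ∉ r) : IsTableau (addCell x p A) := by
  induction A generalizing p T with
  | nil => simp [addCell, IsTableau]
  | cons r A ih =>
    obtain ⟨h1, h2, h3, h4⟩ := hA
    cases T with
    | nil => cases p <;> simp [addCell] at hs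
    | cons s T =>
    cases p with
    | zero =>
      refine ⟨by simp, ?_, h3.append x, h4⟩
      rw [List.pairwise_append]
      refine ⟨h2, by simp, fun a ha b hb => ?_⟩
      obtain rfl := List.mem_singleton.1 hb
      refine lt_of_le_of_ne (hx r (by simp) a ha) ?_
      rintro rfl
      exact hp r (by simp) ha
    | succ p =>
      simp only [addCell, List.map_cons, List.cons.injEq] at hs
      refine ⟨h1, h2, ?_, ih h4 hT.2.2.2 hs.2 (fun r hr => hx r (List.mem_cons_of_mem _ hr))
        (by simpa using hp)⟩
      have hd := hT.2.2.1.length_le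
      rw [← hs.1] at hd
      have hr := hx r (by simp)
      cases A with
      | nil =>
        have := Dominates.append_right (s := []) (by simp) (List.length_pos_iff.2 h1) hr
        cases p <;> exact this
      | cons r' A =>
        cases T with
        | nil => cases p <;> simp [addCell] at hs
        | cons s' T =>
        cases p with
        | zero =>
          simp only [addCell, List.map_cons, List.cons.injEq, List.length_append,
            List.length_singleton] at hs
          refine h3.append_right ?_ hr
          simp only [List.headD_cons] at hd ⊢
          omega
        | succ p => exact h3

lemma mem_addCell (x : α) (p : ℕ) (A : List (List α)) : ∃ r ∈ addCell x p A, x ∈ r := by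
  induction A generalizing p with
  | nil => simp [addCell]
  | cons r A ih =>
    cases p with
    | zero => simp [addCell]
    | succ p =>
      obtain ⟨s, hs, hxs⟩ := ih p
      exact ⟨s, by simp [addCell, hs], hxs⟩

lemma le_of_mem_addCell {x : α} {p : ℕ} {A : List (List α)} (h : ∀ r ∈ A, ∀ a ∈ r, a ≤ x) :
    ∀ r ∈ addCell x p A, ∀ a ∈ r, a ≤ x := by
  induction A generalizing p with
  | nil => simp [addCell]
  | cons r A ih =>
    simp only [List.mem_cons, forall_eq_or_imp] at h
    cases p with
    | zero =>
      simp only [addCell, List.mem_cons, forall_eq_or_imp, List.mem_append]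
      refine ⟨?_, h.2⟩
      rintro a (ha | rfl | ha)
      · exact h.1 a ha
      · exact le_rfl
      · simp at ha
    | succ p =>
      simp only [addCell, List.mem_cons, forall_eq_or_imp]
      exact ⟨h.1, ih h.2⟩

lemma drop_addCell {x : α} {p : ℕ} {A : List (List α)} (hp : p ≤ A.length) :
    (addCell x p A).drop (p + 1) = A.drop (p + 1) := by
  induction A generalizing p with
  | nil => simp [addCell]
  | cons r A ih =>
    cases p with
    | zero => simp [addCell]
    | succ p => simpa [addCell] using ih (by simpa using hp)

lemma lowestRow_addCell {x : α} {p : ℕ} {A : List (List α)} (hp : p ≤ A.length)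
    (h : ∀ r ∈ A.drop p, x ∉ r) : lowestRow x (addCell x p A) = p := by
  induction A generalizing p with
  | nil =>
    obtain rfl : p = 0 := by simpa using hp
    simp [addCell, lowestRow]
  | cons r A ih =>
    cases p with
    | zero =>
      simp only [addCell, lowestRow]
      rw [if_neg]
      rintro ⟨s, hs, hxs⟩
      exact h s (by simp [hs]) hxs
    | succ p =>
      simp only [addCell, lowestRow, if_pos (mem_addCell x p A)]
      rw [ih (by simpa using hp) (by simpa using h)]

lemma modify_addCell {x : α} {p : ℕ} {A : List (List α)} (hp : p ≤ A.length)
    (h : ∀ r ∈ A.drop p, x ∉ r) :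
    (addCell x p A).modify p (fun row => row.erase x) = padTo p A := by
  induction A generalizing p with
  | nil =>
    obtain rfl : p = 0 := by simpa using hp
    simp [addCell, padTo]
  | cons r A ih =>
    cases p with
    | zero =>
      have : x ∉ r := h r (by simp)
      simp [addCell, padTo, List.erase_append_right _ this]
    | succ p =>
      simp only [addCell, List.modify_succ_cons, padTo_cons]
      rw [ih (by simpa using hp) (by simpa using h)]

/-- The added `x` is a maximum of the left tableau, and no lower row contains it, so KRS picks
exactly the row that has grown. If the insertion created that row, the step leaves it behind empty,
whence `padTo`. -/
lemma krsStep_insertion {x : α} {y : β} {A : List (List α)} {B : List (List β)}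
    (hB : IsTableau B) (hs : A.map List.length = B.map List.length)
    (hx : ∀ r ∈ A, ∀ a ∈ r, a ≤ x) (h : ∀ r ∈ A.drop (insertion y B).1, x ∉ r) :
    krsStep (addCell x (insertion y B).1 A) (insertion y B).2 =
      some ((x, y), (padTo (insertion y B).1 A, padTo (insertion y B).1 B)) := by
  have hp : (insertion y B).1 ≤ A.length := by
    have := congrArg List.length hs
    simp only [List.length_map] at this
    exact this ▸ insertion_le y B
  have hmax : (addCell x (insertion y B).1 A).flatten.max? = some x := by
    rw [List.max?_eq_some_iff]
    constructor
    · simpa [List.mem_flatten] using mem_addCell x _ A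
    · intro b hb
      obtain ⟨r, hr, hb⟩ := List.mem_flatten.1 hb
      exact le_of_mem_addCell hx r hr b hb
  rw [krsStep, hmax]
  simp only [lowestRow_addCell hp h, deletion_insertion hB, modify_addCell hp h, Option.map_some]

/-! ### Empty rows do not affect the algorithm -/

lemma lowestRow_append_nil (x : α) (A : List (List α)) :
    lowestRow x (A ++ [[]]) = lowestRow x A := by
  induction A with
  | nil => simp [lowestRow]
  | cons r A ih => simp [lowestRow, ih, or_and_right, exists_or]

lemma lowestRow_lt (x : α) {A : List (List α)} (h : A ≠ []) : lowestRow x A < A.length := by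
  induction A with
  | nil => simp at h
  | cons r A ih =>
    simp only [lowestRow]
    split_ifs with hx
    · have : A ≠ [] := by
        rintro rfl
        simp at hx
      simpa using ih this
    · simp

lemma deletion_append_nil {B : List (List β)} {p : ℕ} (hp : p < B.length) :
    deletion (B ++ [[]]) p = (deletion B p).map fun z => (z.1, z.2 ++ [[]]) := by
  induction B generalizing p with
  | nil => simp at hp
  | cons r B ih =>
    cases p with
    | zero => simp [deletion, Function.comp_def]
    | succ p =>
      simp only [List.cons_append, deletion, ih (p := p) (by simpa using hp)]
      cases deletion B p with
      | none => rfl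
      | some z => simp [Function.comp_def]

lemma deletion_length {B : List (List β)} {p : ℕ} {z : β × List (List β)}
    (h : deletion B p = some z) : z.2.length = B.length := by
  induction B generalizing p z with
  | nil => simp [deletion] at h
  | cons r B ih =>
    cases p with
    | zero =>
      simp only [deletion, Option.map_eq_some_iff] at h
      obtain ⟨_, -, rfl⟩ := h
      simp
    | succ p =>
      simp only [deletion] at h
      split at h
      · simp at h
      · obtain ⟨_, -, rfl⟩ := Option.map_eq_some_iff.1 h
        simp [ih ‹_›]

lemma modify_append_nil (f : List α → List α) {A : List (List α)} {p : ℕ} (hp : p < A.length) :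
    (A ++ [[]]).modify p f = A.modify p f ++ [[]] := by
  induction A generalizing p with
  | nil => simp at hp
  | cons r A ih =>
    cases p with
    | zero => simp
    | succ p => simp [ih (p := p) (by simpa using hp)]

lemma krsArray_append_nil (k : ℕ) {A : List (List α)} {B : List (List β)}
    (h : A.length = B.length) : krsArray k (A ++ [[]]) (B ++ [[]]) = krsArray k A B := by
  induction k generalizing A B with
  | zero => rfl
  | succ k ih =>
    have hf : (A ++ [[]]).flatten = A.flatten := by simp
    simp only [krsArray, krsStep, hf]
    cases hm : A.flatten.max? with
    | none => rfl
    | some a =>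
      have hA : A ≠ [] := by
        rintro rfl
        simp at hm
      have hl := lowestRow_lt a hA
      simp only [lowestRow_append_nil, deletion_append_nil (h ▸ hl), modify_append_nil _ hl]
      cases hd : deletion B (lowestRow a A) with
      | none => rfl
      | some z =>
        simp only [Option.map_some]
        rw [ih]
        simp [deletion_length hd, h]

lemma krsArray_padTo (k p : ℕ) {A : List (List α)} {B : List (List β)}
    (h : A.length = B.length) : krsArray k (padTo p A) (padTo p B) = krsArray k A B := by
  simp only [padTo, h]
  split_ifs
  · rfl
  · exact krsArray_append_nil k h

/-! ### Chains in the two-line array -/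

/-- The array `L` has a chain of length `k`, strictly increasing in both coordinates, with second
coordinates at most `b`. -/
def HasChain (L : List (α × β)) (k : ℕ) (b : β) : Prop :=
  ∃ C : List (α × β), C.Sublist L ∧ C.Pairwise (fun c d => c.1 < d.1 ∧ c.2 < d.2) ∧
    C.length = k ∧ ∀ c ∈ C, c.2 ≤ b

/-- The entry of index `i` of the row is the end of a chain of length `k + i + 1`. -/
def ChainRow (L : List (α × β)) : ℕ → List β → Prop
  | _, [] => True
  | k, b :: r => HasChain L (k + 1) b ∧ ChainRow L (k + 1) r

lemma ChainRow.mono {L L' : List (α × β)} (h : L.Sublist L') {k : ℕ} {r : List β}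
    (hr : ChainRow L k r) : ChainRow L' k r := by
  induction r generalizing k with
  | nil => trivial
  | cons b r ih =>
    obtain ⟨⟨C, h1, h2⟩, h3⟩ := hr
    exact ⟨⟨C, h1.trans h, h2⟩, ih h3⟩

/-- The order of the columns of a two-line array. -/
def ArrayLE (c d : α × β) : Prop := c.1 < d.1 ∨ c.1 = d.1 ∧ d.2 ≤ c.2

/-- The new entry stands immediately to the right of a smaller one, whose chain is extended by `c`.
The first coordinates stay strict because, by `ArrayLE`, columns with equal first coordinate have
weakly decreasing second coordinates. The hypothesis `hk` carries the chain of the left neighbour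
through the induction. -/
lemma ChainRow.rowInsert {L : List (α × β)} {c : α × β} {k : ℕ} {r : List β}
    (hc : ∀ d ∈ L, ArrayLE d c) (hr : ChainRow L k r)
    (hk : ∃ C : List (α × β), C.Sublist L ∧ C.Pairwise (fun c d => c.1 < d.1 ∧ c.2 < d.2) ∧
      C.length = k ∧ ∀ d ∈ C, d.2 < c.2) : ChainRow (L ++ [c]) k (rowInsert c.2 r) := by
  have new : ∀ k, (∃ C : List (α × β), C.Sublist L ∧
      C.Pairwise (fun c d => c.1 < d.1 ∧ c.2 < d.2) ∧
      C.length = k ∧ ∀ d ∈ C, d.2 < c.2) → HasChain (L ++ [c]) (k + 1) c.2 := by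
    rintro k ⟨C, h1, h2, h3, h4⟩
    refine ⟨C ++ [c], h1.append (List.Sublist.refl _), ?_, by simp [h3], ?_⟩
    · rw [List.pairwise_append]
      refine ⟨h2, by simp, fun a ha b hb => ?_⟩
      obtain rfl := List.mem_singleton.1 hb
      refine ⟨?_, h4 a ha⟩
      rcases hc a (h1.subset ha) with h | h
      · exact h
      · exact absurd h.2 (not_le.2 (h4 a ha))
    · intro d hd
      rcases List.mem_append.1 hd with hd | hd
      · exact (h4 d hd).le
      · rw [List.mem_singleton.1 hd]
  induction r generalizing k with
  | nil => exact ⟨new k hk, trivial⟩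
  | cons b r ih =>
    obtain ⟨hb, hr⟩ := hr
    simp only [DetIdeal.rowInsert]
    split_ifs with hy
    · exact ⟨new k hk, hr.mono (List.sublist_append_left _ _)⟩
    · obtain ⟨C, h1, h2, h3, h4⟩ := hb
      exact ⟨⟨C, h1.trans (List.sublist_append_left _ _), h2, h3, h4⟩,
        ih hr ⟨C, h1, h2, h3, fun d hd => (h4 d hd).trans_lt (not_le.1 hy)⟩⟩

lemma ChainRow.exists_chain {L : List (α × β)} {k : ℕ} {r : List β} (hr : ChainRow L k r)
    (h : r ≠ []) : ∃ C : List (α × β), C.Sublist L ∧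
      C.Pairwise (fun c d => c.1 < d.1 ∧ c.2 < d.2) ∧ C.length = k + r.length := by
  induction r generalizing k with
  | nil => exact absurd rfl h
  | cons b r ih =>
    obtain ⟨⟨C, h1, h2, h3, -⟩, hr⟩ := hr
    rcases eq_or_ne r [] with rfl | hne
    · exact ⟨C, h1, h2, h3⟩
    · obtain ⟨C, h1, h2, h3⟩ := ih hr hne
      exact ⟨C, h1, h2, by simp [h3]; omega⟩

/-- Every two-line array is the output of the KRS algorithm for a pair of tableaux of the same
shape, and its chains are at least as long as the first row. -/
lemma exists_tableaux (L : List (α × β)) (hL : L.Pairwise ArrayLE) :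
    ∃ (A : List (List α)) (B : List (List β)), IsTableau A ∧ IsTableau B ∧
      A.map List.length = B.map List.length ∧ (B.map List.length).sum = L.length ∧
      krsArray L.length A B = L ∧ ChainRow L 0 (B.headD []) ∧
      ∀ c ∈ L.getLast?, (∀ r ∈ A, ∀ a ∈ r, a ≤ c.1) ∧
        ∃ B₀ : List (List β), B = (insertion c.2 B₀).2 ∧
          ∀ r ∈ A.drop ((insertion c.2 B₀).1 + 1), c.1 ∉ r := by
  induction L using List.reverseRecOn with
  | nil => exact ⟨[], [], by simp [IsTableau, krsArray, ChainRow]⟩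
  | append_singleton L c ih =>
    rw [List.pairwise_append] at hL
    obtain ⟨A, B, hA, hB, hs, hsum, hk, hch, hlast⟩ := ih hL.1
    have hc : ∀ d ∈ L, ArrayLE d c := fun d hd => hL.2.2 d hd c (by simp)
    have hlen : A.length = B.length := by simpa using congrArg List.length hs
    have hp : (insertion c.2 B).1 ≤ A.length := hlen ▸ insertion_le _ _
    -- If the first coordinate grows, `c.1` exceeds every entry of `A`. If it repeats, the row
    -- bumping lemma puts the new cell below the previous one, where `c.1` does not occur; the last
    -- clause of the statement exists to supply this.
    have hx : (∀ r ∈ A, ∀ a ∈ r, a ≤ c.1) ∧ ∀ r ∈ A.drop (insertion c.2 B).1, c.1 ∉ r := by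
      cases hl : L.getLast? with
      | none =>
        obtain rfl : L = [] := by simpa using hl
        have : B = [] := by
          rcases B with _ | ⟨b, B⟩
          · rfl
          · have := hB.1
            simp at hsum
            exact absurd hsum.1 this
        subst this
        obtain rfl : A = [] := by simpa using hlen
        simp
      | some d =>
        obtain ⟨h1, B₀, rfl, h2⟩ := hlast d hl
        rcases hc d (List.mem_of_getLast? hl) with h | ⟨h, h'⟩
        · refine ⟨fun r hr a ha => (h1 r hr a ha).trans h.le, fun r hr hcr => ?_⟩
          exact absurd (h1 r (List.mem_of_mem_drop hr) _ hcr) (not_le.2 h)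
        · rw [← h]
          refine ⟨h1, fun r hr => h2 r ?_⟩
          exact (List.drop_sublist_drop_left A
            (Nat.succ_le_of_lt (insertion_lt_insertion h' B₀))).subset hr
    have hs' := shape_addCell (x := c.1) (y := c.2) hs
    have hT := isTableau_insertion (y := c.2) hB
    refine ⟨addCell c.1 (insertion c.2 B).1 A, (insertion c.2 B).2,
      isTableau_addCell hA hT hs' hx.1 hx.2, hT, hs', ?_, ?_, ?_, ?_⟩
    · rw [List.length_append, ← hsum]
      generalize c.2 = y
      clear * -
      induction B generalizing y with
      | nil => simp [insertion]
      | cons r B ih =>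
        simp only [insertion]
        split
        · simp; omega
        · simp [ih, (rowBump_eq_some ‹_›).2.2]; omega
    · rw [List.length_append, List.length_singleton, krsArray, krsStep_insertion hB hs hx.1 hx.2]
      simp only [krsArray_padTo _ _ hlen, hk]
    · rw [insertion_headD]
      exact hch.rowInsert hc ⟨[], by simp⟩
    · intro d hd
      obtain rfl : c = d := by simpa using hd
      refine ⟨le_of_mem_addCell hx.1, B, rfl, ?_⟩
      rw [drop_addCell hp]
      intro r hr
      exact hx.2 r ((List.drop_sublist_drop_left A (Nat.le_succ _)).subset hr)

end Insertion

/-! ### Every monomial is a KRS monomial -/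

section Surjective

lemma Dominates.getElem_le {β : Type*} [LinearOrder β] {r s : List β} (h : Dominates r s) (i : ℕ)
    (hs : i < s.length) (hr : i < r.length) : r[i] ≤ s[i] := by
  induction r generalizing s i with
  | nil => simp at hr
  | cons a r ih =>
    cases s with
    | nil => simp at hs
    | cons b s =>
      cases i with
      | zero => exact h.1
      | succ i => exact ih h.2 i (by simpa using hs) (by simpa using hr)

variable {m n : ℕ}

lemma Minor.prec_of_dominates {d e : Minor m n} (hr : Dominates (List.ofFn d.row) (List.ofFn e.row))
    (hc : Dominates (List.ofFn d.col) (List.ofFn e.col)) : d.Prec e := by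
  have h : e.size ≤ d.size := by simpa using hr.length_le
  refine ⟨h, fun i => ⟨?_, ?_⟩⟩
  · have := hr.getElem_le i (by simp) (by simpa using i.2.trans_le h)
    rw [List.getElem_ofFn, List.getElem_ofFn] at this
    exact this
  · have := hc.getElem_le i (by simp) (by simpa using i.2.trans_le h)
    rw [List.getElem_ofFn, List.getElem_ofFn] at this
    exact this

lemma Minor.exists_of_pairwise {a : List (Fin m)} {b : List (Fin n)} (hl : a.length = b.length)
    (h0 : b ≠ []) (ha : a.Pairwise (· < ·)) (hb : b.Pairwise (· < ·)) :
    ∃ d : Minor m n, List.ofFn d.row = a ∧ List.ofFn d.col = b ∧ d.size = b.length := by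
  rw [List.pairwise_iff_getElem] at ha hb
  refine ⟨⟨b.length, List.length_pos_iff.2 h0,
    OrderEmbedding.ofStrictMono (fun i => a[(i : ℕ)]'(hl.symm ▸ i.2 : (i : ℕ) < a.length)) fun i j hij => ha _ _ _ _ hij,
    OrderEmbedding.ofStrictMono (fun i => b[(i : ℕ)]) fun i j hij => hb _ _ _ _ hij⟩, ?_, ?_, rfl⟩
  · refine List.ext_getElem (by simp [hl]) fun i _ _ => ?_
    rw [List.getElem_ofFn]
    rfl
  · refine List.ext_getElem (by simp) fun i _ _ => ?_
    rw [List.getElem_ofFn]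
    rfl

lemma exists_minors {A : List (List (Fin m))} {B : List (List (Fin n))} (hA : IsTableau A)
    (hB : IsTableau B) (hs : A.map List.length = B.map List.length) :
    ∃ l : List (Minor m n), (l.map fun d => List.ofFn d.row) = A ∧
      (l.map fun d => List.ofFn d.col) = B ∧ l.IsChain Minor.Prec ∧
      l.map Minor.size = B.map List.length := by
  induction A generalizing B with
  | nil =>
    obtain rfl : B = [] := by simpa using hs.symm
    exact ⟨[], by simp⟩
  | cons a A ih =>
    cases B with
    | nil => simp at hs
    | cons b B =>
      simp only [List.map_cons, List.cons.injEq] at hs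
      obtain ⟨d, rfl, rfl, hd⟩ := Minor.exists_of_pairwise hs.1 hB.1 hA.2.1 hB.2.1
      obtain ⟨l, rfl, rfl, hl, hl'⟩ := ih hA.2.2.2 hB.2.2.2 hs.2
      refine ⟨d :: l, rfl, rfl, ?_, congrArg₂ List.cons hd hl'⟩
      rw [List.isChain_cons]
      refine ⟨fun e he => ?_, hl⟩
      obtain ⟨l, rfl⟩ : ∃ l', l = e :: l' := by
        cases l with
        | nil => simp at he
        | cons e' l => exact ⟨l, by simpa using he⟩
      exact Minor.prec_of_dominates hA.2.2.1 hB.2.2.1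

/-- The number of boxes of a bitableau. -/
def StdBitableau.boxes (S : StdBitableau m n) : ℕ := (S.minors.map Minor.size).sum

lemma Minor.exists_diag_eq {C : List (Fin m × Fin n)} (h0 : C ≠ [])
    (hC : C.Pairwise fun c d => c.1 < d.1 ∧ c.2 < d.2) :
    ∃ d : Minor m n, d.size = C.length ∧
      d.diag = (C.map fun c => Finsupp.single c 1).sum := by
  rw [List.pairwise_iff_getElem] at hC
  refine ⟨⟨C.length, List.length_pos_iff.2 h0,
    OrderEmbedding.ofStrictMono (fun i => C[(i : ℕ)].1) fun i j hij => (hC _ _ _ _ hij).1,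
    OrderEmbedding.ofStrictMono (fun i => C[(i : ℕ)].2) fun i j hij => (hC _ _ _ _ hij).2⟩, rfl, ?_⟩
  rw [Minor.diag, ← List.sum_ofFn]
  congr 1
  refine List.ext_getElem (by simp) fun i _ _ => ?_
  rw [List.getElem_ofFn, List.getElem_map]
  rfl

lemma sum_map_single_eq {ι : Type*} [DecidableEq ι] (s : Multiset ι) :
    (s.map fun c => Finsupp.single c 1).sum = Multiset.toFinsupp s := by
  induction s using Multiset.induction with
  | empty => simp
  | cons a s ih =>
    rw [Multiset.map_cons, Multiset.sum_cons, ih, ← Multiset.singleton_add, map_add,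
      Multiset.toFinsupp_singleton]

instance : DecidableRel (ArrayLE : Fin m × Fin n → Fin m × Fin n → Prop) :=
  fun c d => inferInstanceAs (Decidable (c.1 < d.1 ∨ c.1 = d.1 ∧ d.2 ≤ c.2))

instance : Std.Total (ArrayLE : Fin m × Fin n → Fin m × Fin n → Prop) where
  total c d := by simp only [ArrayLE]; grind

instance : IsTrans _ (ArrayLE : Fin m × Fin n → Fin m × Fin n → Prop) where
  trans c d e := by simp only [ArrayLE]; grind

/-- The array is the sorted multiset of variables of `u`. Its chain as long as the first row, cut
down to `t` members, is the diagonal of a minor. -/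
lemma exists_bitableau (u : (Fin m × Fin n) →₀ ℕ) :
    ∃ S : StdBitableau m n, S.krsExp = u ∧ S.boxes = u.degree ∧
      ∀ t, 1 ≤ t → t ≤ S.firstLength → ∃ d : Minor m n, d.size = t ∧ d.diag ≤ u := by
  obtain ⟨L, hL, hLu⟩ : ∃ L : List (Fin m × Fin n), L.Pairwise ArrayLE ∧
      (L.map fun c => Finsupp.single c 1).sum = u := by
    refine ⟨(Finsupp.toMultiset u).toList.insertionSort ArrayLE,
      List.pairwise_insertionSort _ _, ?_⟩
    rw [((List.perm_insertionSort _ _).map _).sum_eq, ← Multiset.sum_coe, ← Multiset.map_coe,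
      Multiset.coe_toList, sum_map_single_eq]
    simp
  obtain ⟨A, B, hA, hB, hs, hsum, hk, hch, -⟩ := exists_tableaux L hL
  obtain ⟨l, hlA, hlB, hl, hl'⟩ := exists_minors hA hB hs
  refine ⟨⟨l, hl⟩, ?_, ?_, fun t ht htl => ?_⟩
  · simp only [StdBitableau.krsExp, StdBitableau.array, StdBitableau.left, StdBitableau.right, hlA,
      hlB, hl', hsum, hk, hLu]
  · rw [StdBitableau.boxes, hl', hsum, ← hLu, map_list_sum]
    simp [Function.comp_def]
  · cases l with
    | nil => simp [StdBitableau.firstLength] at htl; omega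
    | cons d l =>
      subst hlB
      obtain ⟨C, hC1, hC2, hC3⟩ := hch.exists_chain
        (by simpa [List.ofFn_eq_nil_iff] using d.size_pos.ne')
      simp only [StdBitableau.firstLength] at htl
      simp only [List.map_cons, List.headD_cons, List.length_ofFn, zero_add] at hC3
      have hlen : (C.take t).length = t := by simp; omega
      obtain ⟨e, he, hed⟩ := Minor.exists_diag_eq (C := C.take t)
        (by rw [← List.length_pos_iff]; omega) (hC2.sublist (List.take_sublist _ _))
      refine ⟨e, he.trans hlen, ?_⟩
      rw [hed, ← hLu]
      exact (((List.take_sublist t C).trans hC1).map _).sum_le_sum fun _ _ => zero_le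

end Surjective

/-! ### Linear independence of the standard bitableaux -/

section Independence

/-- In a linear relation the largest leading monomial occurs only once and cannot cancel. -/
lemma linearIndependent_of_degree_injective {σ ι K : Type*} [Field K] (ord : MonomialOrder σ)
    {f : ι → MvPolynomial σ K} (h0 : ∀ i, f i ≠ 0)
    (hf : Function.Injective fun i => ord.degree (f i)) : LinearIndependent K f := by
  classical
  rw [linearIndependent_iff']
  intro s c hc
  by_contra! hne
  obtain ⟨i₁, hi₁⟩ := hne
  obtain ⟨i, hi, hmax⟩ := (s.filter fun i => c i ≠ 0).exists_max_image
    (fun i => ord.toSyn (ord.degree (f i))) ⟨i₁, by simpa using hi₁⟩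
  rw [Finset.mem_filter] at hi
  have h := congrArg (coeff (ord.degree (f i))) hc
  rw [coeff_sum, Finset.sum_eq_single i, coeff_smul, coeff_zero, smul_eq_mul, mul_eq_zero] at h
  · exact h.elim hi.2 (ord.leadingCoeff_ne_zero_iff.2 (h0 i))
  · intro j hj hji
    rw [coeff_smul]
    by_cases hcj : c j = 0
    · simp [hcj]
    · rw [ord.coeff_eq_zero_of_lt, smul_zero]
      refine lt_of_le_of_ne (hmax j (by simp [hj, hcj])) fun h => hji (hf ?_)
      exact ord.toSyn.injective h
  · exact fun h => absurd hi.1 h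

lemma degree_eq_of_sum_monomial {σ ι R : Type*} [CommSemiring R] (ord : MonomialOrder σ)
    {s : Finset ι} {e : ι → σ →₀ ℕ} {c : ι → R} {i : ι} (hi : i ∈ s) (hc : c i ≠ 0)
    (hlt : ∀ j ∈ s, j ≠ i → ord.toSyn (e j) < ord.toSyn (e i)) :
    (∑ j ∈ s, monomial (e j) (c j)) ≠ 0 ∧ ord.degree (∑ j ∈ s, monomial (e j) (c j)) = e i := by
  classical
  have hcoeff : coeff (e i) (∑ j ∈ s, monomial (e j) (c j)) = c i := by
    rw [coeff_sum, Finset.sum_eq_single i]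
    · simp
    · intro j hj hji
      rw [coeff_monomial, if_neg]
      intro h
      exact (hlt j hj hji).ne (congrArg _ h)
    · exact fun h => absurd hi h
  refine ⟨fun h => hc (by rw [← hcoeff, h, coeff_zero]), ?_⟩
  apply ord.toSyn.injective
  apply le_antisymm
  · rw [ord.degree_le_iff]
    intro b hb
    obtain ⟨j, hj, hb⟩ := Finset.mem_biUnion.1 (support_sum hb)
    obtain rfl := Finset.mem_singleton.1 (support_monomial_subset hb)
    rcases eq_or_ne j i with rfl | hji
    · exact le_rfl
    · exact (hlt j hj hji).le
  · exact ord.le_degree (mem_support_iff.2 (hcoeff ▸ hc))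

/-- The lexicographic order is decided at the smallest variable where the exponents differ. Here
that is `g i`: the other factors agree or involve only later variables. -/
lemma toLex_sum_single_lt {κ ι : Type*} [Fintype κ] [LinearOrder ι] {f g : κ → ι} {i : κ}
    (hi : g i < f i) (h : ∀ j, j ≠ i → f j = g j ∨ g i < f j ∧ g i < g j) :
    toLex (∑ j, Finsupp.single (f j) 1 : ι →₀ ℕ) < toLex (∑ j, Finsupp.single (g j) 1) := by
  classical
  rw [Finsupp.Lex.lt_iff]
  refine ⟨g i, fun q hq => ?_, ?_⟩
  · simp only [ofLex_toLex, Finsupp.finsetSum_apply]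
    refine Finset.sum_congr rfl fun j _ => ?_
    rcases eq_or_ne j i with rfl | hj
    · rw [Finsupp.single_eq_of_ne hq.ne, Finsupp.single_eq_of_ne (hq.trans hi).ne]
    · rcases h j hj with h | ⟨h1, h2⟩
      · rw [h]
      · rw [Finsupp.single_eq_of_ne (hq.trans h1).ne, Finsupp.single_eq_of_ne (hq.trans h2).ne]
  · simp only [ofLex_toLex, Finsupp.finsetSum_apply]
    refine Finset.sum_lt_sum (fun j _ => ?_) ⟨i, Finset.mem_univ i, ?_⟩
    · rcases eq_or_ne j i with rfl | hj
      · rw [Finsupp.single_eq_of_ne hi.ne]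
        exact Nat.zero_le _
      · rcases h j hj with h | ⟨h1, h2⟩
        · rw [h]
        · rw [Finsupp.single_eq_of_ne h1.ne]
          exact Nat.zero_le _
    · rw [Finsupp.single_eq_of_ne hi.ne, Finsupp.single_eq_same]
      exact one_pos

/-- Expansion of the determinant of a product along the rows of the second factor. -/
lemma det_mul_eq_sum {R : Type*} [CommRing R] {s r : ℕ} (A : Matrix (Fin s) (Fin r) R)
    (B : Matrix (Fin r) (Fin s) R) :
    (A * B).det = ∑ p : Fin s → Fin r, (∏ i, A i (p i)) * (B.submatrix p id).det := by
  have h : A * B = fun i => ∑ k, A i k • B k := by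
    ext i j
    simp [Matrix.mul_apply, Finset.sum_apply]
  have h2 := (Matrix.detRowAlternating (n := Fin s) (R := R)).toMultilinearMap.map_sum
    fun i k => A i k • B k
  rw [h]
  refine h2.trans (Finset.sum_congr rfl fun p _ => ?_)
  exact (Matrix.detRowAlternating (n := Fin s) (R := R)).toMultilinearMap.map_smul_univ
    (fun i => A i (p i)) fun i => B (p i)

/-! ### Minors of a product of two generic matrices -/

variable {m n : ℕ}

/-- The positions of the entries of an `m × r` and an `r × n` matrix, ordered lexicographically. -/
abbrev FactorVar (m n r : ℕ) : Type := (Fin m ×ₗ Fin r) ⊕ₗ (Fin r ×ₗ Fin n)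

/-- A position in the left factor. -/
def leftVar (n : ℕ) {r : ℕ} (a : Fin m) (k : Fin r) : FactorVar m n r :=
  toLex (Sum.inl (toLex (a, k)))

/-- A position in the right factor. -/
def rightVar (m : ℕ) {r : ℕ} (k : Fin r) (b : Fin n) : FactorVar m n r :=
  toLex (Sum.inr (toLex (k, b)))

variable {r : ℕ}

lemma leftVar_lt_leftVar {a a' : Fin m} {k k' : Fin r} :
    leftVar n a k < leftVar n a' k' ↔ a < a' ∨ a = a' ∧ k < k' := by
  rw [leftVar, leftVar, Sum.Lex.inl_lt_inl_iff, Prod.Lex.toLex_lt_toLex]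

lemma rightVar_lt_rightVar {k k' : Fin r} {b b' : Fin n} :
    rightVar m k b < rightVar m k' b' ↔ k < k' ∨ k = k' ∧ b < b' := by
  rw [rightVar, rightVar, Sum.Lex.inr_lt_inr_iff, Prod.Lex.toLex_lt_toLex]

lemma leftVar_lt_rightVar {a : Fin m} {k k' : Fin r} {b : Fin n} :
    leftVar n a k < rightVar m k' b := Sum.Lex.inl_lt_inr _ _

lemma leftVar_inj {a a' : Fin m} {k k' : Fin r} :
    leftVar n a k = leftVar n a' k' ↔ a = a' ∧ k = k' := by
  simp [leftVar]

lemma rightVar_inj {k k' : Fin r} {b b' : Fin n} :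
    rightVar m k b = rightVar m k' b' ↔ k = k' ∧ b = b' := by
  simp [rightVar]

variable (K : Type*) [Field K]

/-- The substitution of the product of a generic `m × r` and a generic `r × n` matrix for `X`. -/
noncomputable def factorHom (m n r : ℕ) :
    MvPolynomial (Fin m × Fin n) K →ₐ[K] MvPolynomial (FactorVar m n r) K :=
  aeval fun p => ∑ k : Fin r, X (leftVar n p.1 k) * X (rightVar m k p.2)

lemma factorHom_toPoly (d : Minor m n) : factorHom K m n r (d.toPoly K) =
    ∑ p : Fin d.size → Fin r, (∏ i, X (leftVar n (d.row i) (p i))) *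
      Matrix.det (Matrix.of fun i j => X (rightVar m (p i) (d.col j))) := by
  rw [Minor.toPoly, AlgHom.map_det]
  have : (factorHom K m n r).mapMatrix
      ((Matrix.mvPolynomialX (Fin m) (Fin n) K).submatrix d.row d.col) =
      (Matrix.of fun i k => X (leftVar n (d.row i) k) :
        Matrix (Fin d.size) (Fin r) (MvPolynomial (FactorVar m n r) K)) *
      (Matrix.of fun k j => X (rightVar m k (d.col j)) :
        Matrix (Fin r) (Fin d.size) (MvPolynomial (FactorVar m n r) K)) := by
    ext1 i j
    simp [Matrix.mul_apply, factorHom, Matrix.mvPolynomialX]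
  rw [this, det_mul_eq_sum]
  rfl

lemma factorHom_det_eq_zero {s : ℕ} {k : Fin s → Fin r} {b : Fin s → Fin n}
    (h : ¬ Function.Injective k) :
    Matrix.det (Matrix.of fun i j =>
      (X (rightVar m (k i) (b j)) : MvPolynomial (FactorVar m n r) K)) = 0 := by
  simp only [Function.Injective, not_forall] at h
  obtain ⟨i, j, hij, hne⟩ := h
  exact Matrix.det_zero_of_row_eq hne (funext fun l => by simp [hij])

/-- The substitution kills the minors of size greater than `r`. -/
lemma factorHom_toPoly_eq_zero {d : Minor m n} (hd : r < d.size) :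
    factorHom K m n r (d.toPoly K) = 0 := by
  rw [factorHom_toPoly]
  refine Finset.sum_eq_zero fun p _ => ?_
  rw [factorHom_det_eq_zero, mul_zero]
  intro hp
  have := Fintype.card_le_of_injective p hp
  simp only [Fintype.card_fin] at this
  omega

lemma exists_first {s : ℕ} {P : Fin s → Prop} (h : ∃ i, P i) : ∃ i, P i ∧ ∀ j < i, ¬ P j := by
  obtain ⟨i, hi, hmin⟩ := wellFounded_lt.has_min {i | P i} h
  exact ⟨i, hi, fun j hj hPj => hmin j hPj hj⟩

/-- The values below `i` are already taken by the earlier arguments. -/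
lemma lt_of_injective_of_first_ne {s r : ℕ} (h : s ≤ r) {p : Fin s → Fin r}
    (hp : Function.Injective p) {i : Fin s} (hi : p i ≠ Fin.castLE h i)
    (hj : ∀ j < i, p j = Fin.castLE h j) : Fin.castLE h i < p i := by
  refine lt_of_le_of_ne (not_lt.1 fun hlt => ?_) hi.symm
  have hlt' : (p i : ℕ) < i := hlt
  have hs : (⟨p i, hlt'.trans i.2⟩ : Fin s) < i := hlt'
  exact hs.ne (hp ((hj _ hs).trans rfl))

/-- The exponents in the expansion of a minor of the product of two generic matrices. -/
noncomputable def factorExp (d : Minor m n) (p : Fin d.size → Fin r)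
    (q : Fin d.size → Fin d.size) : FactorVar m n r →₀ ℕ :=
  ∑ j : Fin d.size ⊕ Fin d.size, Finsupp.single
    (Sum.elim (fun i => leftVar n (d.row i) (p i)) (fun i => rightVar m (p i) (d.col (q i))) j) 1

/-- The left variables precede the right ones, so the first place where `p` leaves the inclusion
decides; if there is none, the first place moved by `q` does. -/
lemma factorExp_lt {d : Minor m n} (h : d.size ≤ r) {p : Fin d.size → Fin r}
    (hp : Function.Injective p) {q : Fin d.size → Fin d.size} (hq : Function.Injective q)
    (hne : p ≠ Fin.castLE h ∨ q ≠ id) :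
    toLex (factorExp d p q) < toLex (factorExp d (Fin.castLE h) id) := by
  by_cases hp' : p = Fin.castLE h
  · have hq' : q ≠ id := hne.resolve_left (not_not.2 hp')
    subst hp'
    obtain ⟨i, hi, hmin⟩ := exists_first (Function.ne_iff.1 hq')
    have hlt := lt_of_injective_of_first_ne le_rfl hq hi fun j hj => not_not.1 (hmin j hj)
    refine toLex_sum_single_lt (i := Sum.inr i) ?_ ?_
    · exact rightVar_lt_rightVar.2 (Or.inr ⟨rfl, d.col.strictMono hlt⟩)
    · rintro (j | j) hj
      · exact Or.inl rfl
      · rcases lt_trichotomy j i with hji | rfl | hji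
        · left
          simp [not_not.1 (hmin j hji)]
        · exact absurd rfl hj
        · exact Or.inr ⟨rightVar_lt_rightVar.2 (Or.inl hji), rightVar_lt_rightVar.2 (Or.inl hji)⟩
  · obtain ⟨i, hi, hmin⟩ := exists_first (Function.ne_iff.1 hp')
    have hlt := lt_of_injective_of_first_ne h hp hi fun j hj => not_not.1 (hmin j hj)
    refine toLex_sum_single_lt (i := Sum.inl i) ?_ ?_
    · exact leftVar_lt_leftVar.2 (Or.inr ⟨rfl, hlt⟩)
    · rintro (j | j) hj
      · rcases lt_trichotomy j i with hji | rfl | hji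
        · left
          simp [not_not.1 (hmin j hji)]
        · exact absurd rfl hj
        · have := d.row.strictMono hji
          exact Or.inr ⟨leftVar_lt_leftVar.2 (Or.inl this), leftVar_lt_leftVar.2 (Or.inl this)⟩
      · exact Or.inr ⟨leftVar_lt_rightVar, leftVar_lt_rightVar⟩

/-- In the expansion only injective `p` survive. The term of the inclusion and the identity
permutation is strictly largest and has coefficient `1`, so it survives in every characteristic. -/
lemma factorHom_degree {d : Minor m n} (h : d.size ≤ r) :
    factorHom K m n r (d.toPoly K) ≠ 0 ∧
    MonomialOrder.lex.degree (factorHom K m n r (d.toPoly K)) =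
      factorExp d (Fin.castLE h) id := by
  classical
  have key : factorHom K m n r (d.toPoly K) =
      ∑ x ∈ (Finset.univ.filter fun p : Fin d.size → Fin r => Function.Injective p) ×ˢ
        (Finset.univ : Finset (Equiv.Perm (Fin d.size))),
        monomial (factorExp d x.1 x.2) (((Equiv.Perm.sign x.2 : ℤ) : K)) := by
    rw [factorHom_toPoly, Finset.sum_product, Finset.sum_filter]
    refine Finset.sum_congr rfl fun p _ => ?_
    split_ifs with hp
    · rw [← Matrix.det_transpose, Matrix.det_apply', Finset.mul_sum]
      refine Finset.sum_congr rfl fun q _ => ?_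
      have h1 : monomial (factorExp d p q) (1 : K) =
          (∏ i, X (leftVar n (d.row i) (p i))) * ∏ i, X (rightVar m (p i) (d.col (q i))) := by
        rw [factorExp, monomial_sum_one, Fintype.prod_sum_type]
        rfl
      have h2 : monomial (factorExp d p q) ((Equiv.Perm.sign q : ℤ) : K) =
          ((Equiv.Perm.sign q : ℤ) : MvPolynomial (FactorVar m n r) K) *
            monomial (factorExp d p q) 1 := by
        rw [← map_intCast (C : K →+* MvPolynomial (FactorVar m n r) K), C_mul_monomial, mul_one]
      rw [h2, h1]
      simp only [Matrix.transpose_apply, Matrix.of_apply]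
      ring
    · rw [factorHom_det_eq_zero K hp, mul_zero]
  rw [key]
  have := degree_eq_of_sum_monomial (R := K) (MonomialOrder.lex (σ := FactorVar m n r))
    (s := (Finset.univ.filter fun p : Fin d.size → Fin r => Function.Injective p) ×ˢ
        (Finset.univ : Finset (Equiv.Perm (Fin d.size))))
    (e := fun x => factorExp d x.1 x.2) (c := fun x => ((Equiv.Perm.sign x.2 : ℤ) : K))
    (i := (Fin.castLE h, 1)) (by simp [Fin.castLE_injective]) (by simp) ?_
  · exact this
  · rintro ⟨p, q⟩ hpq hne
    rw [MonomialOrder.lex_lt_iff]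
    refine factorExp_lt h (by simpa using hpq) q.injective ?_
    by_contra! hcon
    exact hne (Prod.ext hcon.1 (Equiv.ext fun i => congrFun hcon.2 i))

lemma factorExp_leftVar_ne_zero {d : Minor m n} (h : d.size ≤ r) (a : Fin m) (k : Fin r) :
    factorExp d (Fin.castLE h) id (leftVar n a k) ≠ 0 ↔
      ∃ hk : (k : ℕ) < d.size, d.row ⟨k, hk⟩ = a := by
  simp only [factorExp, Finsupp.finsetSum_apply, ne_eq, Finset.sum_eq_zero_iff, not_forall,
    Finset.mem_univ, Finsupp.single_apply]
  constructor
  · rintro ⟨j | j, -, hj⟩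
    · have := (ite_ne_right_iff.1 hj).1
      obtain ⟨rfl, rfl⟩ := leftVar_inj.1 this
      exact ⟨j.2, rfl⟩
    · exact absurd (ite_ne_right_iff.1 hj).1 leftVar_lt_rightVar.ne'
  · rintro ⟨hk, rfl⟩
    exact ⟨Sum.inl ⟨k, hk⟩, trivial, by simp⟩

lemma factorExp_rightVar_ne_zero {d : Minor m n} (h : d.size ≤ r) (k : Fin r) (b : Fin n) :
    factorExp d (Fin.castLE h) id (rightVar m k b) ≠ 0 ↔
      ∃ hk : (k : ℕ) < d.size, d.col ⟨k, hk⟩ = b := by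
  simp only [factorExp, Finsupp.finsetSum_apply, ne_eq, Finset.sum_eq_zero_iff, not_forall,
    Finset.mem_univ, Finsupp.single_apply]
  constructor
  · rintro ⟨j | j, -, hj⟩
    · exact absurd (ite_ne_right_iff.1 hj).1 leftVar_lt_rightVar.ne
    · have := (ite_ne_right_iff.1 hj).1
      obtain ⟨rfl, rfl⟩ := rightVar_inj.1 this
      exact ⟨j.2, rfl⟩
  · rintro ⟨hk, rfl⟩
    exact ⟨Sum.inr ⟨k, hk⟩, trivial, by simp⟩

/-! ### Recovering a standard bitableau from its leading exponent -/

lemma Minor.Prec.trans {d e f : Minor m n} (h : d.Prec e) (h' : e.Prec f) : d.Prec f := by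
  obtain ⟨h1, h2⟩ := h
  obtain ⟨h3, h4⟩ := h'
  exact ⟨h3.trans h1, fun i => ⟨(h2 (Fin.castLE h3 i)).1.trans (h4 i).1,
    (h2 (Fin.castLE h3 i)).2.trans (h4 i).2⟩⟩

lemma Minor.Prec.refl (d : Minor m n) : d.Prec d := ⟨le_rfl, fun _ => ⟨le_rfl, le_rfl⟩⟩

lemma Minor.Prec.antisymm {d e : Minor m n} (h : d.Prec e) (h' : e.Prec d) : d = e := by
  obtain ⟨s, hs, a, b⟩ := d
  obtain ⟨s', hs', a', b'⟩ := e
  obtain ⟨h1, h2⟩ := h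
  obtain ⟨h3, h4⟩ := h'
  obtain rfl : s = s' := le_antisymm h3 h1
  congr 1
  · exact DFunLike.ext _ _ fun i => le_antisymm (h2 i).1 (h4 i).1
  · exact DFunLike.ext _ _ fun i => le_antisymm (h2 i).2 (h4 i).2

instance : IsTrans (Minor m n) Minor.Prec := ⟨fun _ _ _ => Minor.Prec.trans⟩

lemma StdBitableau.pairwise (S : StdBitableau m n) : S.minors.Pairwise Minor.Prec :=
  List.isChain_iff_pairwise.1 S.chain

/-- The initial exponent of a minor of the product of two generic matrices. -/
noncomputable def factorLead (r : ℕ) (d : Minor m n) : FactorVar m n r →₀ ℕ :=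
  MonomialOrder.lex.degree (factorHom K m n r (d.toPoly K))

/-- Each variable of the leading monomial of `d` occurs in that of some `f` in `e :: l'`. So the
`i`-th index of `d` is the `i`-th index of such an `f`, which is at least that of `e` because `e` is
the minimum of its chain. -/
lemma prec_of_factorLead_sum {d e : Minor m n} {l l' : List (Minor m n)} (hd : d.size ≤ r)
    (hl' : ∀ f ∈ e :: l', f.size ≤ r) (h' : (e :: l').Pairwise Minor.Prec)
    (h : ((d :: l).map (factorLead K r)).sum = ((e :: l').map (factorLead K r)).sum) :
    e.Prec d := by
  have key : ∀ v, factorLead K r d v ≠ 0 → ∃ f ∈ e :: l', factorLead K r f v ≠ 0 := by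
    intro v hv
    by_contra! hcon
    have h1 : ((e :: l').map (factorLead K r)).sum v = 0 := by
      rw [← Finsupp.applyAddHom_apply, map_list_sum, List.sum_eq_zero_iff]
      simpa using hcon
    rw [← h, List.map_cons, List.sum_cons, Finsupp.add_apply] at h1
    omega
  have hprec : ∀ f ∈ e :: l', e.Prec f := by
    intro f hf
    rcases List.mem_cons.1 hf with rfl | hf
    · exact Minor.Prec.refl _
    · exact (List.pairwise_cons.1 h').1 f hf
  have hrow : ∀ i : Fin d.size, ∃ hi : (i : ℕ) < e.size, e.row ⟨i, hi⟩ ≤ d.row i := by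
    intro i
    obtain ⟨f, hf, hv⟩ := key (leftVar n (d.row i) (Fin.castLE hd i)) (by
      rw [factorLead, (factorHom_degree K hd).2, factorExp_leftVar_ne_zero]
      exact ⟨i.2, rfl⟩)
    rw [factorLead, (factorHom_degree K (hl' f hf)).2, factorExp_leftVar_ne_zero] at hv
    obtain ⟨hi, hfi⟩ := hv
    obtain ⟨h1, h2⟩ := hprec f hf
    exact ⟨hi.trans_le h1, (h2 ⟨i, hi⟩).1.trans hfi.le⟩
  have hcol : ∀ i : Fin d.size, ∃ hi : (i : ℕ) < e.size, e.col ⟨i, hi⟩ ≤ d.col i := by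
    intro i
    obtain ⟨f, hf, hv⟩ := key (rightVar m (Fin.castLE hd i) (d.col i)) (by
      rw [factorLead, (factorHom_degree K hd).2, factorExp_rightVar_ne_zero]
      exact ⟨i.2, rfl⟩)
    rw [factorLead, (factorHom_degree K (hl' f hf)).2, factorExp_rightVar_ne_zero] at hv
    obtain ⟨hi, hfi⟩ := hv
    obtain ⟨h1, h2⟩ := hprec f hf
    exact ⟨hi.trans_le h1, (h2 ⟨i, hi⟩).2.trans hfi.le⟩
  have hsize : d.size ≤ e.size := by
    obtain ⟨h, -⟩ := hrow ⟨d.size - 1, Nat.sub_lt d.size_pos one_pos⟩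
    have := d.size_pos
    simp only at h
    omega
  exact ⟨hsize, fun i => ⟨(hrow i).2, (hcol i).2⟩⟩

lemma factorLead_ne_zero {d : Minor m n} (hd : d.size ≤ r) : factorLead K r d ≠ 0 := by
  intro h
  have : factorLead K r d (leftVar n (d.row ⟨0, d.size_pos⟩)
      (Fin.castLE hd ⟨0, d.size_pos⟩)) ≠ 0 := by
    rw [factorLead, (factorHom_degree K hd).2, factorExp_leftVar_ne_zero]
    exact ⟨d.size_pos, rfl⟩
  exact this (by rw [h]; rfl)

/-- Applied in both directions, `prec_of_factorLead_sum` identifies the first minors; cancel them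
and continue. -/
lemma factorLead_sum_injective {l l' : List (Minor m n)} (hl : ∀ f ∈ l, f.size ≤ r)
    (hl' : ∀ f ∈ l', f.size ≤ r) (hp : l.Pairwise Minor.Prec) (hp' : l'.Pairwise Minor.Prec)
    (h : (l.map (factorLead K r)).sum = (l'.map (factorLead K r)).sum) : l = l' := by
  induction l generalizing l' with
  | nil =>
    cases l' with
    | nil => rfl
    | cons e l' =>
      rw [List.map_nil, List.sum_nil, List.map_cons, List.sum_cons] at h
      exact absurd (add_eq_zero.1 h.symm).1 (factorLead_ne_zero K (hl' e (by simp)))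
  | cons d l ih =>
    cases l' with
    | nil =>
      rw [List.map_nil, List.sum_nil, List.map_cons, List.sum_cons] at h
      exact absurd (add_eq_zero.1 h).1 (factorLead_ne_zero K (hl d (by simp)))
    | cons e l' =>
      obtain rfl : d = e := Minor.Prec.antisymm
        (prec_of_factorLead_sum K (hl' e (by simp)) hl hp h.symm)
        (prec_of_factorLead_sum K (hl d (by simp)) hl' hp' h)
      rw [List.map_cons, List.sum_cons, List.map_cons, List.sum_cons] at h
      rw [ih (fun f hf => hl f (List.mem_cons_of_mem _ hf))
        (fun f hf => hl' f (List.mem_cons_of_mem _ hf)) (List.pairwise_cons.1 hp).2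
        (List.pairwise_cons.1 hp').2 (add_left_cancel h)]

lemma StdBitableau.size_le_firstLength (S : StdBitableau m n) :
    ∀ d ∈ S.minors, d.size ≤ S.firstLength := by
  obtain ⟨l, hl⟩ := S
  rw [List.isChain_iff_pairwise] at hl
  cases l with
  | nil => simp
  | cons e l =>
    intro d hd
    rcases List.mem_cons.1 hd with rfl | hd
    · exact le_rfl
    · exact ((List.pairwise_cons.1 hl).1 d hd).1

lemma factorHom_bitableau {l : List (Minor m n)} (hl : ∀ f ∈ l, f.size ≤ r) :
    factorHom K m n r (l.map (Minor.toPoly K)).prod ≠ 0 ∧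
    MonomialOrder.lex.degree (factorHom K m n r (l.map (Minor.toPoly K)).prod) =
      (l.map (factorLead K r)).sum := by
  induction l with
  | nil => simp
  | cons d l ih =>
    obtain ⟨h1, h2⟩ := ih fun f hf => hl f (List.mem_cons_of_mem _ hf)
    have h3 := (factorHom_degree K (hl d (by simp))).1
    simp only [List.map_cons, List.prod_cons, List.sum_cons, map_mul]
    exact ⟨mul_ne_zero h3 h1, by rw [MonomialOrder.degree_mul h3 h1, h2]; rfl⟩

/-- The standard bitableaux with first row of length at most `r` remain linearly independent in the
polynomial ring of the entries of the two factors. -/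
lemma linearIndependent_factorHom (m n r : ℕ) : LinearIndependent K
    fun S : {S : StdBitableau m n // S.firstLength ≤ r} => factorHom K m n r (S.1.toPoly K) := by
  have hr : ∀ S : {S : StdBitableau m n // S.firstLength ≤ r}, ∀ d ∈ S.1.minors, d.size ≤ r :=
    fun S d hd => (S.1.size_le_firstLength d hd).trans S.2
  refine linearIndependent_of_degree_injective MonomialOrder.lex
    (fun S => (factorHom_bitableau K (hr S)).1) fun S S' h => ?_
  simp only [StdBitableau.toPoly, (factorHom_bitableau K (hr _)).2] at h
  have := factorLead_sum_injective K (hr S) (hr S') S.1.pairwise S'.1.pairwise h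
  obtain ⟨⟨l, _⟩, _⟩ := S
  obtain ⟨⟨l', _⟩, _⟩ := S'
  subst this
  rfl

end Independence

/-! ### The standard basis and the initial space -/

section Basis

/-- The counting principle: `|κ| = dim span v ≤ dim span w ≤ |ι| ≤ |κ|`, so equality holds
throughout. It is used once for the standard basis and once for the initial monomials. -/
lemma surjective_and_span_eq_of_injective {K V ι κ : Type*} [Field K] [AddCommGroup V] [Module K V]
    [Finite ι] {w : ι → V} {v : κ → V} (hv : LinearIndependent K v)
    (h : ∀ i, v i ∈ Submodule.span K (Set.range w)) {g : ι → κ} (hg : Function.Injective g) :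
    Function.Surjective g ∧ Submodule.span K (Set.range v) = Submodule.span K (Set.range w) := by
  have := Fintype.ofFinite ι
  have hfin : FiniteDimensional K (Submodule.span K (Set.range w)) :=
    FiniteDimensional.span_of_finite K (Set.finite_range w)
  have hle : Submodule.span K (Set.range v) ≤ Submodule.span K (Set.range w) := by
    rw [Submodule.span_le]
    rintro _ ⟨i, rfl⟩
    exact h i
  have hv' : LinearIndependent K fun i => (⟨v i, h i⟩ : Submodule.span K (Set.range w)) :=
    LinearIndependent.of_comp (Submodule.subtype _) hv
  have := hv'.finite
  have := Fintype.ofFinite κ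
  have h1 := finrank_range_le_card (R := K) w
  have h2 := finrank_span_eq_card hv
  have h3 := Submodule.finrank_mono hle
  have h4 := Fintype.card_le_of_injective g hg
  rw [Set.finrank] at h1
  exact ⟨((Fintype.bijective_iff_injective_and_card g).2 ⟨hg, by omega⟩).2,
    Submodule.eq_of_le_of_finrank_le hle (by omega)⟩

variable {m n : ℕ} (K : Type*) [Field K]

/-- Laplace expansion along the first row, repeated down to size `t`. -/
lemma det_submatrix_mem_detIdeal {t : ℕ} (ht : 1 ≤ t) (s : ℕ) (hs : t ≤ s) (a : Fin s ↪o Fin m)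
    (b : Fin s ↪o Fin n) :
    ((Matrix.mvPolynomialX (Fin m) (Fin n) K).submatrix a b).det ∈ detIdeal K m n t := by
  induction s, hs using Nat.le_induction with
  | base => exact Ideal.subset_span ⟨⟨t, ht, a, b⟩, rfl, rfl⟩
  | succ s hs ih =>
    rw [Matrix.det_succ_row_zero]
    refine Ideal.sum_mem _ fun j _ => Ideal.mul_mem_left _ _ ?_
    exact ih ((Fin.succOrderEmb s).trans a) ((Fin.succAboveOrderEmb j).trans b)

lemma StdBitableau.toPoly_mem_detIdeal {t : ℕ} (ht : 1 ≤ t) {S : StdBitableau m n}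
    (hS : t ≤ S.firstLength) : S.toPoly K ∈ detIdeal K m n t := by
  obtain ⟨l, hl⟩ := S
  cases l with
  | nil =>
    simp only [StdBitableau.firstLength] at hS
    omega
  | cons d l =>
    rw [StdBitableau.toPoly, List.map_cons, List.prod_cons]
    exact Ideal.mul_mem_right _ _ (det_submatrix_mem_detIdeal K ht _ hS _ _)

lemma Minor.toPoly_isHomogeneous (d : Minor m n) : (d.toPoly K).IsHomogeneous d.size := by
  rw [Minor.toPoly, Matrix.det_apply]
  refine IsHomogeneous.sum _ _ _ fun q _ => ?_
  rw [← mem_homogeneousSubmodule, Units.smul_def, ← Int.cast_smul_eq_zsmul K]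
  refine Submodule.smul_mem _ _ ?_
  rw [mem_homogeneousSubmodule]
  have := IsHomogeneous.prod Finset.univ (fun i => (Matrix.mvPolynomialX (Fin m) (Fin n) K).submatrix
    d.row d.col (q i) i) (fun _ => 1) fun i _ => isHomogeneous_X K _
  simpa using this

lemma StdBitableau.toPoly_isHomogeneous (S : StdBitableau m n) :
    (S.toPoly K).IsHomogeneous S.boxes := by
  rw [StdBitableau.toPoly, StdBitableau.boxes]
  induction S.minors with
  | nil => exact isHomogeneous_one _ _
  | cons d l ih => exact (d.toPoly_isHomogeneous K).mul ih

/-- No minor has more than `m` rows, so the substitution with `r = m` covers all standard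
bitableaux. -/
lemma linearIndependent_toPoly (m n : ℕ) :
    LinearIndependent K fun S : StdBitableau m n => S.toPoly K := by
  have h : ∀ S : StdBitableau m n, S.firstLength ≤ m := by
    rintro ⟨l, hl⟩
    cases l with
    | nil => exact Nat.zero_le _
    | cons d l => simpa [StdBitableau.firstLength] using Fintype.card_le_of_injective d.row d.row.injective
  exact LinearIndependent.of_comp (factorHom K m n m).toLinearMap
    ((linearIndependent_factorHom K m n m).comp (fun S => ⟨S, h S⟩)
      fun S S' hS => congrArg Subtype.val hS)

lemma mem_span_monomial {σ : Type*} {f : MvPolynomial σ K} {N : ℕ} (hf : f.IsHomogeneous N) :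
    f ∈ Submodule.span K (Set.range fun u : {u : σ →₀ ℕ // u.degree = N} => monomial u.1 (1 : K)) := by
  rw [f.as_sum]
  refine Submodule.sum_mem _ fun u hu => ?_
  rw [← mul_one (coeff u f), ← smul_eq_mul, ← smul_monomial]
  refine Submodule.smul_mem _ _ (Submodule.subset_span ⟨⟨u, ?_⟩, rfl⟩)
  rw [Finsupp.degree_eq_weight_one]
  exact hf (mem_support_iff.1 hu)

lemma finite_degree_eq (m n N : ℕ) : Finite {u : (Fin m × Fin n) →₀ ℕ // u.degree = N} :=
  (Finsupp.finite_of_degree_eq N).to_subtype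

/-- A standard bitableau with a given KRS monomial. -/
noncomputable def ofExp (u : (Fin m × Fin n) →₀ ℕ) : StdBitableau m n := (exists_bitableau u).choose

lemma krsExp_ofExp (u : (Fin m × Fin n) →₀ ℕ) : (ofExp u).krsExp = u :=
  (exists_bitableau u).choose_spec.1

lemma boxes_ofExp (u : (Fin m × Fin n) →₀ ℕ) : (ofExp u).boxes = u.degree :=
  (exists_bitableau u).choose_spec.2.1

lemma ofExp_injective : Function.Injective (ofExp : _ → StdBitableau m n) :=
  Function.LeftInverse.injective krsExp_ofExp

/-- Takes the place of straightening: spanning follows from independence and the injection `ofExp`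
of monomials into bitableaux. -/
lemma surjective_and_span_toPoly (m n N : ℕ) :
    (∀ S : StdBitableau m n, S.boxes = N → ∃ u, ofExp u = S) ∧
    Submodule.span K (Set.range fun S : {S : StdBitableau m n // S.boxes = N} => S.1.toPoly K) =
      Submodule.span K (Set.range
        fun u : {u : (Fin m × Fin n) →₀ ℕ // u.degree = N} => monomial u.1 (1 : K)) := by
  have := finite_degree_eq m n N
  obtain ⟨h1, h2⟩ := surjective_and_span_eq_of_injective
    (w := fun u : {u : (Fin m × Fin n) →₀ ℕ // u.degree = N} => monomial u.1 (1 : K))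
    (v := fun S : {S : StdBitableau m n // S.boxes = N} => S.1.toPoly K)
    ((linearIndependent_toPoly K m n).comp _ Subtype.val_injective)
    (fun S => mem_span_monomial K (by have := S.1.toPoly_isHomogeneous K; rwa [S.2] at this))
    (g := fun u => ⟨ofExp u.1, (boxes_ofExp u.1).trans u.2⟩)
    fun u v huv => Subtype.ext (ofExp_injective (congrArg Subtype.val huv))
  refine ⟨fun S hS => ?_, h2⟩
  obtain ⟨u, hu⟩ := h1 ⟨S, hS⟩
  exact ⟨u.1, congrArg Subtype.val hu⟩

lemma ofExp_krsExp (S : StdBitableau m n) : ofExp S.krsExp = S := by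
  -- The claim is purely combinatorial, so any field may be used for the dimension count.
  obtain ⟨u, rfl⟩ := (surjective_and_span_toPoly ℚ m n _).1 S rfl
  rw [krsExp_ofExp]

/-- The KRS correspondence is a bijection between standard bitableaux and monomials. -/
noncomputable def krsExpEquiv (m n : ℕ) : StdBitableau m n ≃ ((Fin m × Fin n) →₀ ℕ) where
  toFun := StdBitableau.krsExp
  invFun := ofExp
  left_inv := ofExp_krsExp
  right_inv := krsExp_ofExp

lemma degree_krsExp (S : StdBitableau m n) : S.krsExp.degree = S.boxes := by
  rw [← boxes_ofExp, ofExp_krsExp]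

lemma exists_diag_le_of_ofExp {t : ℕ} (ht : 1 ≤ t) {u : (Fin m × Fin n) →₀ ℕ}
    (hu : t ≤ (ofExp u).firstLength) : ∃ d : Minor m n, d.size = t ∧ d.diag ≤ u :=
  (exists_bitableau u).choose_spec.2.2 t ht hu

lemma StdBitableau.exists_diag_le {t : ℕ} (ht : 1 ≤ t) {S : StdBitableau m n}
    (hS : t ≤ S.firstLength) : ∃ d : Minor m n, d.size = t ∧ d.diag ≤ S.krsExp :=
  exists_diag_le_of_ofExp ht (by rwa [ofExp_krsExp])

lemma span_toPoly_eq_top (m n : ℕ) :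
    Submodule.span K (Set.range fun S : StdBitableau m n => S.toPoly K) = ⊤ := by
  rw [eq_top_iff, ← (basisMonomials (Fin m × Fin n) K).span_eq, Submodule.span_le]
  rintro _ ⟨u, rfl⟩
  rw [coe_basisMonomials]
  have h : monomial u (1 : K) ∈ Submodule.span K (Set.range
      fun v : {v : (Fin m × Fin n) →₀ ℕ // v.degree = u.degree} => monomial v.1 (1 : K)) :=
    Submodule.subset_span ⟨⟨u, rfl⟩, rfl⟩
  rw [← (surjective_and_span_toPoly K m n u.degree).2] at h
  refine Submodule.span_mono ?_ h
  rintro _ ⟨S, rfl⟩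
  exact ⟨S.1, rfl⟩

/-- The standard bitableaux with first row of length at least `t` span the ideal. -/
lemma span_toPoly_eq_detIdeal (m n : ℕ) {t : ℕ} (ht : 1 ≤ t) :
    Submodule.span K (Set.range fun S : {S : StdBitableau m n // t ≤ S.firstLength} =>
      S.1.toPoly K) = (detIdeal K m n t).restrictScalars K := by
  have hle : Submodule.span K (Set.range fun S : {S : StdBitableau m n // t ≤ S.firstLength} =>
      S.1.toPoly K) ≤ (detIdeal K m n t).restrictScalars K := by
    rw [Submodule.span_le]
    rintro _ ⟨S, rfl⟩
    exact S.1.toPoly_mem_detIdeal K ht S.2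
  refine le_antisymm hle fun f hf => ?_
  -- A product through `t - 1` columns has rank less than `t`, so its `t`-minors vanish.
  have hker : detIdeal K m n t ≤ RingHom.ker (factorHom K m n (t - 1)) := by
    rw [detIdeal, Ideal.span_le]
    rintro _ ⟨d, hd, rfl⟩
    exact factorHom_toPoly_eq_zero K (by omega)
  have htop : f ∈ Submodule.span K (Set.range fun S : StdBitableau m n => S.toPoly K) := by
    rw [span_toPoly_eq_top]
    trivial
  have hsplit : (Set.range fun S : StdBitableau m n => S.toPoly K) =
      (Set.range fun S : {S : StdBitableau m n // t ≤ S.firstLength} => S.1.toPoly K) ∪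
      Set.range fun S : {S : StdBitableau m n // S.firstLength ≤ t - 1} => S.1.toPoly K := by
    ext g
    constructor
    · rintro ⟨S, rfl⟩
      rcases le_or_gt t S.firstLength with h | h
      · exact Or.inl ⟨⟨S, h⟩, rfl⟩
      · exact Or.inr ⟨⟨S, by omega⟩, rfl⟩
    · rintro (⟨S, rfl⟩ | ⟨S, rfl⟩) <;> exact ⟨S.1, rfl⟩
  rw [hsplit, Submodule.span_union, Submodule.mem_sup] at htop
  obtain ⟨f₁, h₁, f₂, h₂, rfl⟩ := htop
  -- The part `f₂` made of short bitableaux lies in the ideal, hence is killed by the substitution;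
  -- their images being independent, all its coefficients vanish.
  have hf₂ : f₂ ∈ detIdeal K m n t := by
    have := Ideal.sub_mem _ (Submodule.restrictScalars_mem K _ _ |>.1 hf)
      (Submodule.restrictScalars_mem K _ _ |>.1 (hle h₁))
    simpa using this
  have h0 : factorHom K m n (t - 1) f₂ = 0 := hker hf₂
  rw [← Finsupp.range_linearCombination] at h₂
  obtain ⟨c, rfl⟩ := h₂
  rw [← AlgHom.toLinearMap_apply, Finsupp.apply_linearCombination] at h0
  have hc : c = 0 :=
    (linearIndependent_iff.1 (linearIndependent_factorHom K m n (t - 1))) c h0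
  simpa [hc] using h₁

lemma homogeneousComponent_mem_span {t : ℕ} (ht : 1 ≤ t) {f : MvPolynomial (Fin m × Fin n) K}
    (hf : f ∈ detIdeal K m n t) (N : ℕ) : homogeneousComponent N f ∈ Submodule.span K
      (Set.range fun S : {S : StdBitableau m n // t ≤ S.firstLength ∧ S.boxes = N} =>
        S.1.toPoly K) := by
  have hf' : f ∈ (detIdeal K m n t).restrictScalars K := hf
  rw [← span_toPoly_eq_detIdeal K m n ht] at hf'
  induction hf' using Submodule.span_induction with
  | mem x hx =>
    obtain ⟨S, rfl⟩ := hx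
    rw [homogeneousComponent_of_mem ((mem_homogeneousSubmodule _ _).2
      (S.1.toPoly_isHomogeneous K))]
    split_ifs with h
    · exact Submodule.subset_span ⟨⟨S.1, S.2, h.symm⟩, rfl⟩
    · exact Submodule.zero_mem _
  | zero => rw [map_zero]; exact Submodule.zero_mem _
  | add x y hx hy hx' hy' =>
    rw [span_toPoly_eq_detIdeal K m n ht] at hx hy
    rw [map_add]
    exact Submodule.add_mem _ (hx' hx) (hy' hy)
  | smul a x hx hx' =>
    rw [span_toPoly_eq_detIdeal K m n ht] at hx
    rw [map_smul]
    exact Submodule.smul_mem _ _ (hx' hx)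

lemma degree_homogeneousComponent {σ : Type*} (ord : MonomialOrder σ) {f : MvPolynomial σ K}
    (hf : f ≠ 0) :
    homogeneousComponent (ord.degree f).degree f ≠ 0 ∧
      ord.degree (homogeneousComponent (ord.degree f).degree f) = ord.degree f := by
  have h : coeff (ord.degree f) (homogeneousComponent (ord.degree f).degree f) ≠ 0 := by
    rw [coeff_homogeneousComponent, if_pos rfl]
    exact ord.leadingCoeff_ne_zero_iff.2 hf
  refine ⟨fun h0 => h (by rw [h0, coeff_zero]), ?_⟩
  apply ord.toSyn.injective
  apply le_antisymm
  · rw [ord.degree_le_iff]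
    intro b hb
    refine ord.le_degree ?_
    rw [mem_support_iff, coeff_homogeneousComponent] at hb
    exact mem_support_iff.2 (ite_ne_right_iff.1 hb).2
  · exact ord.le_degree (mem_support_iff.2 h)

/-! ### Initial monomials of the determinantal ideal -/

variable {K} {ord : MonomialOrder (Fin m × Fin n)}

lemma Minor.toPoly_ne_zero (hord : IsDiagonal K ord) (d : Minor m n) : d.toPoly K ≠ 0 := by
  intro h
  have h1 := hord d
  rw [h, MonomialOrder.degree_zero] at h1
  have h2 := congrArg Finsupp.degree h1
  rw [Minor.diag, map_sum] at h2
  simp at h2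
  exact d.size_pos.ne h2

/-- Every multiple of the diagonal of a `t`-minor is an initial monomial. -/
lemma exists_degree_eq_of_diag_le (hord : IsDiagonal K ord) {d : Minor m n}
    {u : (Fin m × Fin n) →₀ ℕ} (h : d.diag ≤ u) :
    ∃ f ∈ detIdeal K m n d.size, f ≠ 0 ∧ ord.degree f = u := by
  have h1 : monomial (u - d.diag) (1 : K) ≠ 0 := by simp
  have h2 := d.toPoly_ne_zero hord
  refine ⟨monomial (u - d.diag) 1 * d.toPoly K,
    Ideal.mul_mem_left _ _ (Ideal.subset_span ⟨d, rfl, rfl⟩), mul_ne_zero h1 h2, ?_⟩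
  classical
  rw [MonomialOrder.degree_mul h1 h2, hord d, MonomialOrder.degree_monomial, if_neg one_ne_zero,
    tsub_add_cancel_of_le h]

/-- Count in degree `N`: the KRS exponents of the basis elements with `N` boxes inject into the set
`U` of initial exponents, and `U` is no larger than the number of these basis elements. -/
lemma exists_krsExp_eq_degree (hord : IsDiagonal K ord) {t : ℕ} (ht : 1 ≤ t)
    {f : MvPolynomial (Fin m × Fin n) K} (hf : f ∈ detIdeal K m n t) (h0 : f ≠ 0) :
    ∃ S : StdBitableau m n, t ≤ S.firstLength ∧ S.krsExp = ord.degree f := by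
  set N := (ord.degree f).degree
  let U := {u : (Fin m × Fin n) →₀ ℕ //
    u.degree = N ∧ ∃ f ∈ detIdeal K m n t, f ≠ 0 ∧ ord.degree f = u}
  -- Passing to the homogeneous component of degree `N` keeps the leading monomial and lands in a
  -- finite-dimensional space.
  have hU : ∀ u : U, ∃ g ∈ Submodule.span K (Set.range
      fun S : {S : StdBitableau m n // t ≤ S.firstLength ∧ S.boxes = N} => S.1.toPoly K),
      g ≠ 0 ∧ ord.degree g = u.1 := by
    rintro ⟨u, hu, g, hg, hg0, rfl⟩
    have h := degree_homogeneousComponent K ord hg0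
    rw [hu] at h
    exact ⟨_, homogeneousComponent_mem_span K ht hg N, h⟩
  choose g hg hg0 hgu using hU
  have hfin : Finite {S : StdBitableau m n // t ≤ S.firstLength ∧ S.boxes = N} := by
    have := finite_degree_eq m n N
    exact Finite.of_injective (β := {u : (Fin m × Fin n) →₀ ℕ // u.degree = N})
      (fun S => ⟨S.1.krsExp, (degree_krsExp S.1).trans S.2.2⟩) fun S S' h =>
        Subtype.ext ((krsExpEquiv m n).injective (congrArg Subtype.val h))
  have hS : ∀ S : {S : StdBitableau m n // t ≤ S.firstLength ∧ S.boxes = N},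
      S.1.krsExp.degree = N ∧ ∃ f ∈ detIdeal K m n t, f ≠ 0 ∧ ord.degree f = S.1.krsExp := by
    intro S
    obtain ⟨d, hd, hle⟩ := StdBitableau.exists_diag_le ht S.2.1
    have h := exists_degree_eq_of_diag_le hord hle
    rw [hd] at h
    exact ⟨(degree_krsExp S.1).trans S.2.2, h⟩
  obtain ⟨h1, -⟩ := surjective_and_span_eq_of_injective
    (linearIndependent_of_degree_injective ord hg0 fun u v huv => Subtype.ext (by simpa [hgu] using huv))
    hg (g := fun S => (⟨S.1.krsExp, hS S⟩ : U)) fun S S' h =>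
      Subtype.ext ((krsExpEquiv m n).injective (congrArg Subtype.val h))
  obtain ⟨S, hSf⟩ := h1 ⟨ord.degree f, rfl, f, hf, h0, rfl⟩
  exact ⟨S.1, S.2.1, congrArg Subtype.val hSf⟩

lemma iniMonomials_detIdeal (hord : IsDiagonal K ord) {t : ℕ} (ht : 1 ≤ t) :
    iniMonomials ord (detIdeal K m n t : Set (MvPolynomial (Fin m × Fin n) K)) =
      Set.range fun S : {S : StdBitableau m n // t ≤ S.firstLength} => S.1.krs K := by
  ext g
  constructor
  · rintro ⟨f, hf, h0, rfl⟩
    obtain ⟨S, hS, hSf⟩ := exists_krsExp_eq_degree hord ht hf h0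
    exact ⟨⟨S, hS⟩, by simp [StdBitableau.krs, hSf]⟩
  · rintro ⟨S, rfl⟩
    obtain ⟨d, rfl, hle⟩ := StdBitableau.exists_diag_le ht S.2
    obtain ⟨f, hf, h0, hfS⟩ := exists_degree_eq_of_diag_le hord hle
    exact ⟨f, hf, h0, by simp [StdBitableau.krs, hfS]⟩

lemma iniMonomials_minorSet (hord : IsDiagonal K ord) (t : ℕ) :
    iniMonomials ord (minorSet K m n t) =
      (fun u => monomial u 1) '' {u | ∃ d : Minor m n, d.size = t ∧ d.diag = u} := by
  ext g
  constructor
  · rintro ⟨_, ⟨d, hd, rfl⟩, -, rfl⟩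
    exact ⟨_, ⟨d, hd, rfl⟩, by simp [hord d]⟩
  · rintro ⟨_, ⟨d, hd, rfl⟩, rfl⟩
    exact ⟨d.toPoly K, ⟨d, hd, rfl⟩, d.toPoly_ne_zero hord, by simp [hord d]⟩

lemma isGroebnerBasis_minorSet (hord : IsDiagonal K ord) {t : ℕ} (ht : 1 ≤ t) :
    IsGroebnerBasis ord (minorSet K m n t) (detIdeal K m n t) := by
  refine ⟨Ideal.subset_span, le_antisymm ?_ fun f hf => ?_⟩
  · rw [iniSpace, iniMonomials_detIdeal hord ht, Submodule.span_le]
    rintro _ ⟨S, rfl⟩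
    obtain ⟨d, hd, hle⟩ := StdBitableau.exists_diag_le ht S.2
    rw [SetLike.mem_coe, Submodule.restrictScalars_mem, iniMonomials_minorSet hord,
      mem_ideal_span_monomial_image]
    intro u hu
    obtain rfl := Finset.mem_singleton.1 (support_monomial_subset hu)
    exact ⟨_, ⟨d, hd, rfl⟩, hle⟩
  · rw [Submodule.restrictScalars_mem, iniMonomials_minorSet hord,
      mem_ideal_span_monomial_image] at hf
    rw [f.as_sum]
    refine Submodule.sum_mem _ fun u hu => ?_
    obtain ⟨_, ⟨d, rfl, rfl⟩, hle⟩ := hf u hu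
    obtain ⟨g, hg, h0, rfl⟩ := exists_degree_eq_of_diag_le hord hle
    rw [← mul_one (coeff (ord.degree g) f), ← smul_eq_mul, ← smul_monomial]
    exact Submodule.smul_mem _ _ (Submodule.subset_span ⟨g, hg, h0, rfl⟩)

/-- The standard bitableaux as a basis of the polynomial ring. -/
noncomputable def stdBasis (K : Type*) [Field K] (m n : ℕ) :
    Module.Basis (StdBitableau m n) K (MvPolynomial (Fin m × Fin n) K) :=
  Module.Basis.mk (linearIndependent_toPoly K m n) (span_toPoly_eq_top K m n).ge

/-- The linear extension of the KRS correspondence. -/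
noncomputable def krsLinearEquiv (K : Type*) [Field K] (m n : ℕ) :
    MvPolynomial (Fin m × Fin n) K ≃ₗ[K] MvPolynomial (Fin m × Fin n) K :=
  (stdBasis K m n).equiv (basisMonomials _ K) (krsExpEquiv m n)

lemma stdBasis_apply (S : StdBitableau m n) : stdBasis K m n S = S.toPoly K :=
  Module.Basis.mk_apply _ _ S

lemma krsLinearEquiv_toPoly (S : StdBitableau m n) :
    krsLinearEquiv K m n (S.toPoly K) = S.krs K := by
  rw [← stdBasis_apply, krsLinearEquiv, Module.Basis.equiv_apply, coe_basisMonomials]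
  rfl

end Basis

end DetIdeal

theorem theorem5p2 (K : Type*) [Field K] (m n t : ℕ) (ht : 1 ≤ t) (htm : t ≤ m) (htn : t ≤ n)
    (ord : MonomialOrder (Fin m × Fin n)) (hord : DetIdeal.IsDiagonal K ord) :
    -- the `t`-minors form a Gröbner basis of the determinantal ideal
    DetIdeal.IsGroebnerBasis ord (DetIdeal.minorSet K m n t) (DetIdeal.detIdeal K m n t) ∧
    -- the standard bitableaux with first row of length at least `t` are a basis of the ideal
    LinearIndependent K
      (fun S : {S : DetIdeal.StdBitableau m n // t ≤ S.firstLength} => S.1.toPoly K) ∧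
    Submodule.span K
      (Set.range fun S : {S : DetIdeal.StdBitableau m n // t ≤ S.firstLength} => S.1.toPoly K) =
      (DetIdeal.detIdeal K m n t).restrictScalars K ∧
    -- the initial ideal is the span of the KRS images of this basis
    DetIdeal.iniSpace ord (DetIdeal.detIdeal K m n t) =
      Submodule.span K
        (Set.range fun S : {S : DetIdeal.StdBitableau m n // t ≤ S.firstLength} => S.1.krs K) ∧
    -- KRS extends uniquely to a linear map, this map is an automorphism of the vector space
    -- `K[X]`, and it maps the determinantal ideal onto its initial ideal
    ∃ krs : MvPolynomial (Fin m × Fin n) K ≃ₗ[K] MvPolynomial (Fin m × Fin n) K,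
      DetIdeal.ExtendsKRS krs.toLinearMap ∧
      (∀ f : MvPolynomial (Fin m × Fin n) K →ₗ[K] MvPolynomial (Fin m × Fin n) K,
        DetIdeal.ExtendsKRS f → f = krs.toLinearMap) ∧
      DetIdeal.iniSpace ord (DetIdeal.detIdeal K m n t) =
        ((DetIdeal.detIdeal K m n t).restrictScalars K).map krs.toLinearMap := by
  have hini : DetIdeal.iniSpace ord (DetIdeal.detIdeal K m n t) = Submodule.span K
      (Set.range fun S : {S : DetIdeal.StdBitableau m n // t ≤ S.firstLength} => S.1.krs K) := by
    rw [DetIdeal.iniSpace, DetIdeal.iniMonomials_detIdeal hord ht]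
  refine ⟨DetIdeal.isGroebnerBasis_minorSet hord ht,
    (DetIdeal.linearIndependent_toPoly K m n).comp _ Subtype.val_injective,
    DetIdeal.span_toPoly_eq_detIdeal K m n ht, hini,
    DetIdeal.krsLinearEquiv K m n, DetIdeal.krsLinearEquiv_toPoly, fun f hf => ?_, ?_⟩
  · refine (DetIdeal.stdBasis K m n).ext fun S => ?_
    rw [DetIdeal.stdBasis_apply, hf S]
    exact (DetIdeal.krsLinearEquiv_toPoly S).symm
  · rw [hini, ← DetIdeal.span_toPoly_eq_detIdeal K m n ht, Submodule.map_span, ← Set.range_comp]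
    congr 2
    funext S
    exact (DetIdeal.krsLinearEquiv_toPoly S.1).symm
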